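/- Let $n\ge 1$, $0\le\lambda<\infty$, $0<p<\infty$, $\vec q=(q_1,\dots,q_n)$ with $1<q_i<\infty$ for all $i$, and $$\lambda-\sum_{i=1}^n\frac1{q_i}<\alpha<n-\sum_{i=1}^n\frac1{q_i}.$$ For measurable $f$ on $\mathbb R^n$ let $$\|f\|_{L^{\vec q}}=\Big(\int_{\mathbb R}\cdots\Big(\int_{\mathbb R}|f(x_1,\dots,x_n)|^{q_1}\,dx_1\Big)^{q_2/q_1}\cdots\,dx_n\Big)^{1/q_n},$$ let $L^{\vec q}(\mathbb R^n)$ be the set of measurable $f$ with $\|f\|_{L^{\vec q}}<\infty$, and let $L^{\vec q}_{loc}(\mathbb R^n)$ be the set of measurable $f$ with $f\chi_K\in L^{\vec q}(\mathbb R^n)$ for every compact $K\subset\mathbb R^n$. With $A_k=\{x\in\mathbb R^n: 2^{k-1}<|x|\le 2^k\}$ and $\chi_k=\chi_{A_k}$ $(k\in\mathbb Z)$, let $$\|f\|_{M\dot K^{\alpha,\lambda}_{p,\vec q}}=\sup_{k_0\in\mathbb Z}2^{-k_0\lambda}\Big(\sum_{k=-\infty}^{k_0}2^{k\alpha p}\|f\chi_k\|_{L^{\vec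 q}}^p\Big)^{1/p},\qquad M\dot K^{\alpha,\lambda}_{p,\vec q}(\mathbb R^n)=\{f\in L^{\vec q}_{loc}(\mathbb R^n):\|f\|_{M\dot K^{\alpha,\lambda}_{p,\vec q}}<\infty\}.$$ Let $b\in BMO(\mathbb R^n)$, i.e. $b$ is locally integrable and $\sup_B\frac1{|B|}\int_B|b-b_B|<\infty$, the supremum being over all balls $B$ and $b_B$ denoting the average of $b$ over $B$. With $B(x,r)=\{y:|x-y|\le r\}$, let $$M_bf(x)=\sup_{r>0}\frac1{|B(x,r)|}\int_{B(x,r)}|b(x)-b(y)|\,|f(y)|\,dy .$$ Suppose that $M_b$ is bounded on $L^{\vec q}(\mathbb R^n)$, i.e. there is $C_0<\infty$ such that for all $f\in L^{\vec q}(\mathbb R^n)$ one has $M_bf\in L^{\vec q}(\mathbb R^n)$ and $\|M_bf\|_{L^{\vec q}}\le C_0\|f\|_{L^{\vec q}}$. Then $M_b$ is bounded on $M\dot K^{\alpha,\lambda}_{p,\vec q}(\mathbb R^n)$: there is $C<\infty$ such that for all $f\in M\dot K^{\alpha,\lambda}_{p,\vec q}(\mathbb R^n)$ one has $M_bf\in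 M\dot K^{\alpha,\lambda}_{p,\vec q}(\mathbb R^n)$ and $$\|M_bf\|_{M\dot K^{\alpha,\lambda}_{p,\vec q}}\le C\,\|f\|_{M\dot K^{\alpha,\lambda}_{p,\vec q}}.$$ -/

import Mathlib

open MeasureTheory Metric
open scoped ENNReal NNReal

noncomputable section

namespace HerzMorrey

/-- The iterated (Benedek–Panzone) norm of a nonnegative function of `n` real variables:
the `L^{q 0}` norm in the first variable is taken first (innermost), then the `L^{q 1}` norm in
the second variable, and so on; the last variable is integrated last. The exponents are meant to
be positive and finite. -/
def iterNorm : (n : ℕ) → (Fin n → ℝ) → ((Fin n → ℝ) → ℝ≥0∞) → ℝ≥0∞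
  | 0, _, F => F Fin.elim0
  | n + 1, q, F =>
      iterNorm n (fun i => q i.succ)
        (fun y => (∫⁻ t : ℝ, F (Fin.cons t y) ^ q 0) ^ (1 / q 0))

section Spaces

variable {n : ℕ} {E : Type*} [TopologicalSpace E] [ESeminormedAddMonoid E]

/-- The mixed Lebesgue norm `‖f‖_{L^q}` with `q = (q 0, …, q (n - 1))`. The values of `f` may be
scalars or extended nonnegative reals. -/
def mixedNorm (q : Fin n → ℝ) (f : EuclideanSpace ℝ (Fin n) → E) : ℝ≥0∞ :=
  iterNorm n q (fun x => ‖f (WithLp.toLp 2 x)‖ₑ)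

/-- Membership in the mixed Lebesgue space `L^q(ℝⁿ)`. -/
def MemMixedLp (q : Fin n → ℝ) (f : EuclideanSpace ℝ (Fin n) → E) : Prop :=
  AEStronglyMeasurable f volume ∧ mixedNorm q f < ∞

/-- Membership in `L^q_loc(ℝⁿ)`: `f χ_K ∈ L^q(ℝⁿ)` for every compact set `K`. -/
def MemMixedLpLoc (q : Fin n → ℝ) (f : EuclideanSpace ℝ (Fin n) → E) : Prop :=
  AEStronglyMeasurable f volume ∧
    ∀ K : Set (EuclideanSpace ℝ (Fin n)), IsCompact K → MemMixedLp q (K.indicator f)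

/-- The dyadic annulus `A_k = B_k \ B_{k-1}`, where `B_k = {x : |x| ≤ 2 ^ k}`. -/
def annulus (n : ℕ) (k : ℤ) : Set (EuclideanSpace ℝ (Fin n)) :=
  closedBall 0 ((2 : ℝ) ^ k) \ closedBall 0 ((2 : ℝ) ^ (k - 1))

/-- The homogeneous mixed Herz–Morrey norm
`sup_{k₀ ∈ ℤ} 2^{-k₀ lam} (∑_{k ≤ k₀} 2^{k α p} ‖f χ_{A_k}‖_{L^q}^p)^{1/p}`. -/
def herzMorreyNorm (α lam p : ℝ) (q : Fin n → ℝ) (f : EuclideanSpace ℝ (Fin n) → E) : ℝ≥0∞ :=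
  ⨆ k₀ : ℤ, (2 : ℝ≥0∞) ^ (-(k₀ : ℝ) * lam) *
    (∑' k : Set.Iic k₀, (2 : ℝ≥0∞) ^ (((k : ℤ) : ℝ) * α * p) *
      mixedNorm q ((annulus n k).indicator f) ^ p) ^ (1 / p)

/-- Membership in the homogeneous mixed Herz–Morrey space. -/
def MemHerzMorrey (α lam p : ℝ) (q : Fin n → ℝ) (f : EuclideanSpace ℝ (Fin n) → E) : Prop :=
  MemMixedLpLoc q f ∧ herzMorreyNorm α lam p q f < ∞

end Spaces

section Commutator

variable {n : ℕ} {𝕜 : Type*} [RCLike 𝕜]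

/-- The BMO seminorm `sup_B (1/|B|) ∫_B |b - b_B|` over all balls `B`, where `b_B` is the average
of `b` over `B`. -/
def bmoSeminorm (b : EuclideanSpace ℝ (Fin n) → 𝕜) : ℝ≥0∞ :=
  ⨆ (x : EuclideanSpace ℝ (Fin n)) (r : ℝ) (_ : 0 < r),
    (volume (closedBall x r))⁻¹ *
      ∫⁻ y in closedBall x r, ‖b y - ⨍ z in closedBall x r, b z‖ₑ

/-- `b ∈ BMO(ℝⁿ)`. -/
def MemBMO (b : EuclideanSpace ℝ (Fin n) → 𝕜) : Prop :=
  LocallyIntegrable b volume ∧ bmoSeminorm b < ∞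

/-- The Hardy–Littlewood maximal commutator
`M_b f(x) = sup_{r > 0} (1/|B(x,r)|) ∫_{B(x,r)} |b(x) - b(y)| |f(y)| dy`, with values in
`[0, ∞]`. -/
def maximalCommutator (b f : EuclideanSpace ℝ (Fin n) → 𝕜) (x : EuclideanSpace ℝ (Fin n)) :
    ℝ≥0∞ :=
  ⨆ (r : ℝ) (_ : 0 < r),
    (volume (closedBall x r))⁻¹ * ∫⁻ y in closedBall x r, ‖b x - b y‖ₑ * ‖f y‖ₑ

end Commutator

end HerzMorrey

end

/-! Write `σ = ∑ 1 / q i`, `B_k` for the ball of radius `2 ^ k` about the origin, and `f_l = f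
χ_{A_l}`. Everything reduces to one interaction estimate,
`mixedNorm_indicator_maximalCommutator_block_le`: `‖χ_{A_k} M_b f_l‖ ≤ K w(k - l) ‖f_l‖` with `w(j)
= (|j| + 1) 2^{-max(j,0) n + j σ}`.

For `|k - l| ≤ 1` this is the assumed bound on `L^q`. Otherwise points of the two annuli are at
distance at least `2^{max(k,l) - 2}`, so only balls of comparable or larger radius matter and `M_b
f_l(x)` is at most a multiple of `2^{-max(k,l) n} ∫ |b(x) - b(y)| |f_l(y)| dy`. Insert the averages
of `b` over `B_k` and `B_l`. They differ by `O(|k - l|)` times the BMO seminorm. The two oscillation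
terms would usually call for John–Nirenberg and duality in mixed norms. Here both come from the
hypothesis on `M_b` itself: on a ball `B`, `|b - b_B|` is controlled by `M_b χ_B`, and `∫ |b - b_B|
|f|` is controlled, after Fubini, by `∫_B M_b f`.

With the weights `2^{kα}` included, the block norms of `M_b f` are dominated by a convolution over
`ℤ` with kernel `K w(j) 2^{jα}`. A shift by `j` costs `2^{-jλ}` in the discrete Morrey norm
(`morrey_convolution_le`), so it remains to sum powers of `w(j) 2^{j(α - λ)}`. The series converges
at `+∞` since `α < n - σ` and `λ ≥ 0`, and at `-∞` since `α > λ - σ` (`tsum_blockWeight_lt_top`). -/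

noncomputable section

namespace HerzMorrey

/-! ### Countable sums in `L^q`: Minkowski for exponents at least 1, subadditivity of powers below
1. -/

section Minkowski

theorem sum_rpow_le_of_le_one {ι : Type*} (s : Finset ι) (f : ι → ℝ≥0∞) {p : ℝ} (hp : 0 < p)
    (hp1 : p ≤ 1) : (∑ i ∈ s, f i) ^ p ≤ ∑ i ∈ s, f i ^ p := by
  classical
  induction s using Finset.induction_on with
  | empty => simp [hp]
  | insert a s ha ih =>
    rw [Finset.sum_insert ha, Finset.sum_insert ha]
    exact (ENNReal.rpow_add_le_add_rpow _ _ hp.le hp1).trans (by gcongr)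

theorem tsum_rpow_eq_iSup {ι : Type*} (f : ι → ℝ≥0∞) {p : ℝ} (hp : 0 < p) :
    (∑' i, f i) ^ p = ⨆ s : Finset ι, (∑ i ∈ s, f i) ^ p := by
  rw [ENNReal.tsum_eq_iSup_sum]
  exact (ENNReal.orderIsoRpow p hp).map_iSup _

theorem tsum_rpow_le_of_le_one {ι : Type*} (f : ι → ℝ≥0∞) {p : ℝ} (hp : 0 < p)
    (hp1 : p ≤ 1) : (∑' i, f i) ^ p ≤ ∑' i, f i ^ p := by
  rw [tsum_rpow_eq_iSup f hp]
  exact iSup_le fun s => (sum_rpow_le_of_le_one s f hp hp1).trans (ENNReal.sum_le_tsum s)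

variable {α : Type*} [MeasurableSpace α] {μ : Measure α}

theorem lintegral_sum_rpow_le {ι : Type*} (s : Finset ι) {F : ι → α → ℝ≥0∞} {q : ℝ}
    (hq : 1 ≤ q) (hF : ∀ i, AEMeasurable (F i) μ) :
    (∫⁻ a, (∑ i ∈ s, F i a) ^ q ∂μ) ^ (1 / q) ≤ ∑ i ∈ s, (∫⁻ a, F i a ^ q ∂μ) ^ (1 / q) := by
  classical
  have hq0 : 0 < q := by linarith
  induction s using Finset.induction_on with
  | empty => simp [hq0]
  | insert i s hi ih =>
    simp only [Finset.sum_insert hi]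
    refine (ENNReal.lintegral_Lp_add_le (f := F i) (g := fun a => ∑ j ∈ s, F j a) (hF i)
      (Finset.aemeasurable_fun_sum _ fun j _ => hF j) hq).trans ?_
    gcongr

/-- Minkowski's inequality for countable sums. -/
theorem lintegral_tsum_rpow_le {ι : Type*} [Countable ι] {F : ι → α → ℝ≥0∞} {q : ℝ}
    (hq : 1 ≤ q) (hF : ∀ i, AEMeasurable (F i) μ) :
    (∫⁻ a, (∑' i, F i a) ^ q ∂μ) ^ (1 / q) ≤ ∑' i, (∫⁻ a, F i a ^ q ∂μ) ^ (1 / q) := by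
  classical
  have hq0 : 0 < q := by linarith
  simp only [tsum_rpow_eq_iSup _ hq0]
  rw [lintegral_iSup_directed]
  · rw [one_div]
    refine ((ENNReal.orderIsoRpow q⁻¹ (inv_pos.2 hq0)).map_iSup _).le.trans
      (iSup_le fun s => ?_)
    have := lintegral_sum_rpow_le (μ := μ) s hq hF
    rw [one_div] at this
    exact this.trans (ENNReal.sum_le_tsum s)
  · exact fun s => (Finset.aemeasurable_fun_sum _ fun j _ => hF j).pow_const _
  · intro s t
    refine ⟨s ∪ t, fun a => ?_, fun a => ?_⟩
    · exact ENNReal.rpow_le_rpow (Finset.sum_le_sum_of_subset Finset.subset_union_left) hq0.le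
    · exact ENNReal.rpow_le_rpow (Finset.sum_le_sum_of_subset Finset.subset_union_right) hq0.le

end Minkowski

/-! ### The iterated norm: monotonicity, Minkowski, cubes and Hölder. -/

section Iterated

theorem measurable_cons {n : ℕ} :
    Measurable fun z : ℝ × (Fin n → ℝ) => (Fin.cons z.1 z.2 : Fin (n + 1) → ℝ) := by
  refine measurable_pi_lambda _ fun i => ?_
  refine Fin.cases ?_ (fun j => ?_) i
  · simpa using measurable_fst
  · simpa [Function.comp_def] using (measurable_pi_apply j).comp measurable_snd

theorem measurePreserving_cons {n : ℕ} :
    MeasurePreserving (fun z : ℝ × (Fin n → ℝ) => (Fin.cons z.1 z.2 : Fin (n + 1) → ℝ)) := by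
  have h := (volume_preserving_piFinSuccAbove (fun _ : Fin (n + 1) => ℝ) 0).symm
  convert h using 1
  ext z i
  simp [MeasurableEquiv.piFinSuccAbove, Fin.insertNthEquiv]

theorem ae_ae_cons {n : ℕ} {P : (Fin (n + 1) → ℝ) → Prop} (h : ∀ᵐ x, P x) :
    ∀ᵐ y : Fin n → ℝ, ∀ᵐ t : ℝ, P (Fin.cons t y) := by
  have h1 : ∀ᵐ z : ℝ × (Fin n → ℝ), P (Fin.cons z.1 z.2) :=
    measurePreserving_cons.quasiMeasurePreserving.ae h
  have h2 : ∀ᵐ z : (Fin n → ℝ) × ℝ, P (Fin.cons z.2 z.1) :=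
    (Measure.measurePreserving_swap (μ := (volume : Measure (Fin n → ℝ)))
      (ν := (volume : Measure ℝ))).quasiMeasurePreserving.ae h1
  exact Measure.ae_ae_of_ae_prod h2

theorem lintegral_cons {n : ℕ} {F : (Fin (n + 1) → ℝ) → ℝ≥0∞} (hF : Measurable F) :
    ∫⁻ x, F x = ∫⁻ y : Fin n → ℝ, ∫⁻ t : ℝ, F (Fin.cons t y) := by
  rw [← measurePreserving_cons.lintegral_comp hF]
  exact lintegral_prod_symm' _ (hF.comp measurable_cons)

theorem measurable_inner_norm {n : ℕ} {F : (Fin (n + 1) → ℝ) → ℝ≥0∞} (hF : Measurable F)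
    (r : ℝ) : Measurable fun y : Fin n → ℝ => (∫⁻ t : ℝ, F (Fin.cons t y) ^ r) ^ (1 / r) :=
  (Measurable.lintegral_prod_left'
    (f := fun z : ℝ × (Fin n → ℝ) => F (Fin.cons z.1 z.2) ^ r)
    ((hF.comp measurable_cons).pow_const r)).pow_const _

/-- Only null sets have to be sliced by Fubini, so neither function need be measurable. -/
theorem iterNorm_mono_ae : ∀ {n : ℕ} {q : Fin n → ℝ}, (∀ i, 0 < q i) →
    ∀ {F G : (Fin n → ℝ) → ℝ≥0∞}, (∀ᵐ x, F x ≤ G x) → iterNorm n q F ≤ iterNorm n q G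
  | 0, q, _, F, G, h => by
    -- In dimension zero the measure is nonzero on a single point, so "almost everywhere" yields a
    -- witness.
    have : ∀ᵐ x : Fin 0 → ℝ, F Fin.elim0 ≤ G Fin.elim0 := by
      filter_upwards [h] with x hx
      rwa [Subsingleton.elim x Fin.elim0] at hx
    obtain ⟨x, hx⟩ := this.exists
    exact hx
  | n + 1, q, hq, F, G, h => by
    refine iterNorm_mono_ae (fun i => hq i.succ) ?_
    filter_upwards [ae_ae_cons h] with y hy
    have h0 := hq 0
    refine ENNReal.rpow_le_rpow (lintegral_mono_ae ?_) (by positivity)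
    filter_upwards [hy] with t ht
    exact ENNReal.rpow_le_rpow ht h0.le

theorem iterNorm_congr_ae {n : ℕ} {q : Fin n → ℝ} (hq : ∀ i, 0 < q i)
    {F G : (Fin n → ℝ) → ℝ≥0∞} (h : ∀ᵐ x, F x = G x) : iterNorm n q F = iterNorm n q G :=
  le_antisymm (iterNorm_mono_ae hq (h.mono fun _ hx => hx.le))
    (iterNorm_mono_ae hq (h.mono fun _ hx => hx.ge))

theorem iterNorm_const_mul_le : ∀ {n : ℕ} {q : Fin n → ℝ}, (∀ i, 0 < q i) →
    ∀ {c : ℝ≥0∞}, c ≠ ∞ → ∀ F : (Fin n → ℝ) → ℝ≥0∞,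
      iterNorm n q (fun x => c * F x) ≤ c * iterNorm n q F
  | 0, q, _, c, _, F => le_rfl
  | n + 1, q, hq, c, hc, F => by
    have h0 := hq 0
    have : ∀ y : Fin n → ℝ, (∫⁻ t : ℝ, (c * F (Fin.cons t y)) ^ q 0) ^ (1 / q 0)
        = c * (∫⁻ t : ℝ, F (Fin.cons t y) ^ q 0) ^ (1 / q 0) := by
      intro y
      simp_rw [ENNReal.mul_rpow_of_nonneg _ _ h0.le]
      rw [lintegral_const_mul' _ _ (ENNReal.rpow_ne_top_of_nonneg h0.le hc),
        ENNReal.mul_rpow_of_nonneg _ _ (by positivity), ← ENNReal.rpow_mul,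
        mul_one_div_cancel h0.ne', ENNReal.rpow_one]
    simp only [iterNorm, this]
    exact iterNorm_const_mul_le (fun i => hq i.succ) hc _

theorem iterNorm_tsum_le_of_measurable {ι : Type*} [Countable ι] :
    ∀ {n : ℕ} {q : Fin n → ℝ}, (∀ i, 1 ≤ q i) →
    ∀ {F : ι → (Fin n → ℝ) → ℝ≥0∞}, (∀ i, Measurable (F i)) →
      iterNorm n q (fun x => ∑' i, F i x) ≤ ∑' i, iterNorm n q (F i)
  | 0, q, _, F, _ => le_rfl
  | n + 1, q, hq, F, hF => by
    refine le_trans ?_ (iterNorm_tsum_le_of_measurable (fun i => hq i.succ)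
      fun i => measurable_inner_norm (hF i) (q 0))
    refine iterNorm_mono_ae (fun i => zero_lt_one.trans_le (hq i.succ))
      (Filter.Eventually.of_forall fun y => ?_)
    exact lintegral_tsum_rpow_le (hq 0) fun i =>
      ((hF i).comp (measurable_cons.comp measurable_prodMk_right)).aemeasurable

theorem iterNorm_tsum_le {ι : Type*} [Countable ι] {n : ℕ} {q : Fin n → ℝ} (hq : ∀ i, 1 ≤ q i)
    {F : ι → (Fin n → ℝ) → ℝ≥0∞} (hF : ∀ i, AEMeasurable (F i)) :
    iterNorm n q (fun x => ∑' i, F i x) ≤ ∑' i, iterNorm n q (F i) := by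
  have hq0 : ∀ i, 0 < q i := fun i => zero_lt_one.trans_le (hq i)
  have h1 : ∀ i, iterNorm n q (F i) = iterNorm n q ((hF i).mk _) := fun i =>
    iterNorm_congr_ae hq0 (hF i).ae_eq_mk
  simp_rw [h1]
  refine le_trans (le_of_eq (iterNorm_congr_ae hq0 ?_))
    (iterNorm_tsum_le_of_measurable hq fun i => (hF i).measurable_mk)
  filter_upwards [ae_all_iff.2 fun i => (hF i).ae_eq_mk] with x hx
  simp_rw [hx]

/-- The cube `[-R, R]ⁿ`. -/
def cube (n : ℕ) (R : ℝ) : Set (Fin n → ℝ) := {x | ∀ i, x i ∈ Set.Icc (-R) R}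

theorem measurableSet_cube (n : ℕ) (R : ℝ) : MeasurableSet (cube n R) := by
  have : cube n R = Set.pi Set.univ fun _ => Set.Icc (-R) R := by
    ext; simp only [cube, Set.mem_ofPred_eq, Set.mem_pi, Set.mem_univ, true_imp_iff]
  rw [this]
  exact MeasurableSet.univ_pi fun _ => measurableSet_Icc

theorem cons_mem_cube {n : ℕ} {R t : ℝ} {y : Fin n → ℝ} :
    (Fin.cons t y : Fin (n + 1) → ℝ) ∈ cube (n + 1) R ↔ t ∈ Set.Icc (-R) R ∧ y ∈ cube n R := by
  simp [cube, Fin.forall_fin_succ]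

theorem volume_Icc_neg_self (R : ℝ) : volume (Set.Icc (-R) R) = ENNReal.ofReal (2 * R) := by
  rw [Real.volume_Icc]
  ring_nf

/-- Cubes replace balls because their indicator is a product and the iterated norm factors; a ball
lies in the cube of the same radius, which costs only a constant. -/
theorem iterNorm_cube_le {R : ℝ} : ∀ {n : ℕ} {q : Fin n → ℝ}, (∀ i, 0 < q i) →
    iterNorm n q ((cube n R).indicator 1) ≤ ∏ i, ENNReal.ofReal (2 * R) ^ (1 / q i)
  | 0, q, _ => by simp [iterNorm, cube]
  | n + 1, q, hq => by
    have h0 := hq 0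
    have key : ∀ y : Fin n → ℝ,
        (∫⁻ t : ℝ, (cube (n + 1) R).indicator 1 (Fin.cons t y) ^ q 0) ^ (1 / q 0)
        = ENNReal.ofReal (2 * R) ^ (1 / q 0) * (cube n R).indicator 1 y := by
      intro y
      by_cases hy : y ∈ cube n R
      · have : ∀ t : ℝ, (cube (n + 1) R).indicator (1 : (Fin (n + 1) → ℝ) → ℝ≥0∞) (Fin.cons t y) ^ q 0
            = (Set.Icc (-R) R).indicator 1 t := by
          intro t
          by_cases ht : t ∈ Set.Icc (-R) R
          · rw [Set.indicator_of_mem (cons_mem_cube.2 ⟨ht, hy⟩), Set.indicator_of_mem ht]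
            simp
          · rw [Set.indicator_of_notMem (fun h => ht (cons_mem_cube.1 h).1),
              Set.indicator_of_notMem ht, ENNReal.zero_rpow_of_pos h0]
        simp_rw [this]
        rw [lintegral_indicator_one measurableSet_Icc, volume_Icc_neg_self,
          Set.indicator_of_mem hy]
        simp
      · have : ∀ t : ℝ, (cube (n + 1) R).indicator (1 : (Fin (n + 1) → ℝ) → ℝ≥0∞) (Fin.cons t y) ^ q 0 = 0 := by
          intro t
          rw [Set.indicator_of_notMem (fun h => hy (cons_mem_cube.1 h).2),
            ENNReal.zero_rpow_of_pos h0]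
        simp_rw [this]
        rw [Set.indicator_of_notMem hy]
        simp [h0]
    simp only [iterNorm, key]
    rw [Fin.prod_univ_succ]
    refine (iterNorm_const_mul_le (fun i => hq i.succ)
      (ENNReal.rpow_ne_top_of_nonneg (by positivity) ENNReal.ofReal_ne_top) _).trans ?_
    gcongr
    exact iterNorm_cube_le fun i => hq i.succ

theorem setLIntegral_le_rpow_mul {μ : Measure ℝ} {s : Set ℝ} {r : ℝ} (hr : 1 < r)
    {f : ℝ → ℝ≥0∞} (hf : AEMeasurable f μ) :
    ∫⁻ t in s, f t ∂μ ≤ μ s ^ (1 - 1 / r) * (∫⁻ t, f t ^ r ∂μ) ^ (1 / r) := by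
  have hc : r.HolderConjugate (Real.conjExponent r) := Real.HolderConjugate.conjExponent hr
  have h := ENNReal.lintegral_mul_le_Lp_mul_Lq (μ.restrict s) hc hf.restrict
    (aemeasurable_const (b := (1 : ℝ≥0∞)))
  simp only [Pi.mul_apply, mul_one, ENNReal.one_rpow, lintegral_const, one_mul,
    Measure.restrict_apply_univ] at h
  rw [mul_comm]
  refine h.trans ?_
  have : 1 / Real.conjExponent r = 1 - 1 / r := by
    have := hc.inv_add_inv_eq_one
    simp only [one_div]
    linarith
  rw [this]
  gcongr
  exact Measure.restrict_le_self

/-- Hölder in one variable at a time, against the indicator of an interval. -/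
theorem lintegral_cube_le {R : ℝ} : ∀ {n : ℕ} {q : Fin n → ℝ}, (∀ i, 1 < q i) →
    ∀ {F : (Fin n → ℝ) → ℝ≥0∞}, Measurable F →
      ∫⁻ x, (cube n R).indicator F x ≤
        (∏ i, ENNReal.ofReal (2 * R) ^ (1 - 1 / q i)) * iterNorm n q F
  | 0, q, _, F, _ => by
    simp only [Finset.univ_eq_empty, Finset.prod_empty, one_mul, iterNorm]
    refine (lintegral_mono (Set.indicator_le_self _ _)).trans ?_
    have : F = fun _ => F Fin.elim0 := funext fun x => congrArg F (Subsingleton.elim _ _)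
    rw [this]
    simp [volume_pi]
  | n + 1, q, hq, F, hF => by
    have h0 : 0 < q 0 := zero_lt_one.trans (hq 0)
    set G : (Fin n → ℝ) → ℝ≥0∞ := fun y => (∫⁻ t : ℝ, F (Fin.cons t y) ^ q 0) ^ (1 / q 0)
      with hG
    rw [lintegral_cons (hF.indicator (measurableSet_cube _ _))]
    have key : ∀ y : Fin n → ℝ, ∫⁻ t : ℝ, (cube (n + 1) R).indicator F (Fin.cons t y)
        ≤ ENNReal.ofReal (2 * R) ^ (1 - 1 / q 0) * (cube n R).indicator G y := by
      intro y
      by_cases hy : y ∈ cube n R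
      · have : ∀ t : ℝ, (cube (n + 1) R).indicator F (Fin.cons t y)
            = (Set.Icc (-R) R).indicator (fun t => F (Fin.cons t y)) t := by
          intro t
          by_cases ht : t ∈ Set.Icc (-R) R
          · rw [Set.indicator_of_mem (cons_mem_cube.2 ⟨ht, hy⟩), Set.indicator_of_mem ht]
          · rw [Set.indicator_of_notMem (fun h => ht (cons_mem_cube.1 h).1),
              Set.indicator_of_notMem ht]
        simp_rw [this]
        rw [lintegral_indicator measurableSet_Icc, Set.indicator_of_mem hy,
          ← volume_Icc_neg_self]
        exact setLIntegral_le_rpow_mul (hq 0)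
          (hF.comp (measurable_cons.comp measurable_prodMk_right)).aemeasurable
      · have : ∀ t : ℝ, (cube (n + 1) R).indicator F (Fin.cons t y) = 0 := fun t =>
          Set.indicator_of_notMem (fun h => hy (cons_mem_cube.1 h).2) _
        simp [this]
    refine (lintegral_mono key).trans ?_
    rw [lintegral_const_mul _
      ((measurable_inner_norm hF (q 0)).indicator (measurableSet_cube _ _)),
      Fin.prod_univ_succ, mul_assoc]
    gcongr
    exact lintegral_cube_le (fun i => hq i.succ) (measurable_inner_norm hF (q 0))

end Iterated

/-! ### Transfer to Euclidean space; norms and volumes of dyadic balls. -/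

section Mixed

variable {n : ℕ} {q : Fin n → ℝ}

theorem mixedNorm_mono_ae {E E' : Type*} [TopologicalSpace E] [ESeminormedAddMonoid E]
    [TopologicalSpace E'] [ESeminormedAddMonoid E'] (hq : ∀ i, 0 < q i)
    {f : EuclideanSpace ℝ (Fin n) → E} {g : EuclideanSpace ℝ (Fin n) → E'}
    (h : ∀ᵐ x, ‖f x‖ₑ ≤ ‖g x‖ₑ) : mixedNorm q f ≤ mixedNorm q g :=
  iterNorm_mono_ae hq ((PiLp.volume_preserving_toLp (Fin n)).quasiMeasurePreserving.ae h)

theorem mixedNorm_mono {E E' : Type*} [TopologicalSpace E] [ESeminormedAddMonoid E]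
    [TopologicalSpace E'] [ESeminormedAddMonoid E'] (hq : ∀ i, 0 < q i)
    {f : EuclideanSpace ℝ (Fin n) → E} {g : EuclideanSpace ℝ (Fin n) → E'}
    (h : ∀ x, ‖f x‖ₑ ≤ ‖g x‖ₑ) : mixedNorm q f ≤ mixedNorm q g :=
  mixedNorm_mono_ae hq (Filter.Eventually.of_forall h)

theorem mixedNorm_const_mul_le (hq : ∀ i, 0 < q i) {c : ℝ≥0∞} (hc : c ≠ ∞)
    (g : EuclideanSpace ℝ (Fin n) → ℝ≥0∞) :
    mixedNorm q (fun x => c * g x) ≤ c * mixedNorm q g :=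
  iterNorm_const_mul_le hq hc _

theorem mixedNorm_tsum_le {ι : Type*} [Countable ι] (hq : ∀ i, 1 ≤ q i)
    {F : ι → EuclideanSpace ℝ (Fin n) → ℝ≥0∞} (hF : ∀ i, AEMeasurable (F i)) :
    mixedNorm q (fun x => ∑' i, F i x) ≤ ∑' i, mixedNorm q (F i) :=
  iterNorm_tsum_le hq fun i => (hF i).comp_quasiMeasurePreserving
    (PiLp.volume_preserving_toLp (Fin n)).quasiMeasurePreserving

theorem mixedNorm_add_le (hq : ∀ i, 1 ≤ q i)
    {f g : EuclideanSpace ℝ (Fin n) → ℝ≥0∞} (hf : AEMeasurable f) (hg : AEMeasurable g) :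
    mixedNorm q (fun x => f x + g x) ≤ mixedNorm q f + mixedNorm q g := by
  have h := mixedNorm_tsum_le (F := fun i : Bool => bif i then f else g) hq
    (by rintro (_ | _) <;> assumption)
  simpa [tsum_fintype] using h

theorem prod_rpow_eq_rpow_sum {ι : Type*} (s : Finset ι) {a : ℝ≥0∞} (h0 : a ≠ 0) (ht : a ≠ ∞)
    (f : ι → ℝ) : ∏ i ∈ s, a ^ f i = a ^ ∑ i ∈ s, f i := by
  classical
  induction s using Finset.induction_on with
  | empty => simp
  | insert i s hi ih => rw [Finset.prod_insert hi, Finset.sum_insert hi,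
      ENNReal.rpow_add _ _ h0 ht, ih]

theorem ofReal_two_zpow (k : ℤ) : ENNReal.ofReal ((2 : ℝ) ^ k) = (2 : ℝ≥0∞) ^ (k : ℝ) := by
  rw [← Real.rpow_intCast, ← ENNReal.ofReal_rpow_of_pos two_pos]
  simp

theorem ofReal_two_mul_two_zpow (k : ℤ) :
    ENNReal.ofReal (2 * (2 : ℝ) ^ k) = (2 : ℝ≥0∞) ^ ((k : ℝ) + 1) := by
  have : (2 : ℝ) * 2 ^ k = 2 ^ (k + 1) := by rw [zpow_add₀ two_ne_zero]; ring
  rw [this, ofReal_two_zpow]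
  push_cast
  rfl

theorem mem_cube_of_norm_le {R : ℝ} {x : Fin n → ℝ}
    (h : WithLp.toLp 2 x ∈ closedBall (0 : EuclideanSpace ℝ (Fin n)) R) : x ∈ cube n R := by
  intro i
  rw [mem_closedBall_zero_iff] at h
  have := (PiLp.norm_apply_le (WithLp.toLp 2 x) i).trans h
  rw [Real.norm_eq_abs] at this
  exact abs_le.1 this

theorem mixedNorm_closedBall_le (hq : ∀ i, 0 < q i) (k : ℤ) :
    mixedNorm q ((closedBall 0 ((2 : ℝ) ^ k)).indicator (1 : EuclideanSpace ℝ (Fin n) → ℝ≥0∞))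
      ≤ (2 : ℝ≥0∞) ^ (((k : ℝ) + 1) * ∑ i, 1 / q i) := by
  have h := iterNorm_cube_le (R := (2 : ℝ) ^ k) hq
  rw [ofReal_two_mul_two_zpow, prod_rpow_eq_rpow_sum _ (by simp) (by simp),
    ← ENNReal.rpow_mul] at h
  refine le_trans (iterNorm_mono_ae hq (Filter.Eventually.of_forall fun x => ?_)) h
  by_cases hx : WithLp.toLp 2 x ∈ closedBall (0 : EuclideanSpace ℝ (Fin n)) ((2 : ℝ) ^ k)
  · rw [Set.indicator_of_mem hx, Set.indicator_of_mem (mem_cube_of_norm_le hx)]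
    simp
  · rw [Set.indicator_of_notMem hx]
    simp

theorem setLIntegral_closedBall_le (hq : ∀ i, 1 < q i) (k : ℤ)
    {g : EuclideanSpace ℝ (Fin n) → ℝ≥0∞} (hg : AEMeasurable g) :
    ∫⁻ x in closedBall 0 ((2 : ℝ) ^ k), g x
      ≤ (2 : ℝ≥0∞) ^ (((k : ℝ) + 1) * (n - ∑ i, 1 / q i)) * mixedNorm q g := by
  have hq0 : ∀ i, 0 < q i := fun i => zero_lt_one.trans (hq i)
  have hmp := PiLp.volume_preserving_toLp (Fin n)
  -- The slicewise Hölder argument needs a genuinely measurable function.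
  set G := hg.mk g
  have hGm : Measurable G := hg.measurable_mk
  have h := lintegral_cube_le (R := (2 : ℝ) ^ k) hq (hGm.comp hmp.measurable)
  rw [ofReal_two_mul_two_zpow, prod_rpow_eq_rpow_sum _ (by simp) (by simp),
    ← ENNReal.rpow_mul] at h
  simp only [Finset.sum_sub_distrib, Finset.sum_const, Finset.card_univ, Fintype.card_fin,
    nsmul_eq_mul, mul_one] at h
  have h1 : ∫⁻ x in closedBall 0 ((2 : ℝ) ^ k), g x
      ≤ ∫⁻ x, (cube n ((2 : ℝ) ^ k)).indicator (G ∘ WithLp.toLp 2) x := by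
    rw [setLIntegral_congr_fun_ae measurableSet_closedBall
      (hg.ae_eq_mk.mono fun x hx _ => hx), ← lintegral_indicator measurableSet_closedBall,
      ← hmp.lintegral_comp (hGm.indicator measurableSet_closedBall)]
    refine lintegral_mono fun x => ?_
    by_cases hx : WithLp.toLp 2 x ∈ closedBall (0 : EuclideanSpace ℝ (Fin n)) ((2 : ℝ) ^ k)
    · rw [Set.indicator_of_mem hx, Set.indicator_of_mem (mem_cube_of_norm_le hx)]
      rfl
    · rw [Set.indicator_of_notMem hx]
      simp
  refine h1.trans (h.trans ?_)
  gcongr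
  refine iterNorm_mono_ae hq0 ?_
  filter_upwards [hmp.quasiMeasurePreserving.ae hg.ae_eq_mk] with x hx
  exact hx.ge

theorem volume_closedBall_two_zpow (x : EuclideanSpace ℝ (Fin n)) (k : ℤ) :
    volume (closedBall x ((2 : ℝ) ^ k)) =
      (2 : ℝ≥0∞) ^ ((k : ℝ) * n) * volume (ball (0 : EuclideanSpace ℝ (Fin n)) 1) := by
  rw [Measure.addHaar_closedBall _ _ (by positivity), ENNReal.ofReal_pow (by positivity),
    ofReal_two_zpow, finrank_euclideanSpace_fin, ENNReal.rpow_mul, ENNReal.rpow_natCast]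

theorem volume_closedBall_two_zpow_ne_zero (x : EuclideanSpace ℝ (Fin n)) (k : ℤ) :
    volume (closedBall x ((2 : ℝ) ^ k)) ≠ 0 :=
  (measure_closedBall_pos volume x (by positivity)).ne'

theorem volume_closedBall_two_zpow_add_one (x y : EuclideanSpace ℝ (Fin n)) (k : ℤ) :
    volume (closedBall x ((2 : ℝ) ^ (k + 1))) =
      (2 : ℝ≥0∞) ^ (n : ℝ) * volume (closedBall y ((2 : ℝ) ^ k)) := by
  rw [volume_closedBall_two_zpow, volume_closedBall_two_zpow, ← mul_assoc,
    ← ENNReal.rpow_add _ _ (by simp) (by simp)]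
  congr 2
  push_cast
  ring

end Mixed

/-! ### Oscillation about an average. -/

section Average

variable {𝕜 : Type*} [RCLike 𝕜] {α : Type*} [MeasurableSpace α] {μ : Measure α}

theorem enorm_sub_setAverage_le {s : Set α} (h0 : μ s ≠ 0) (ht : μ s ≠ ∞) {b : α → 𝕜}
    (hb : IntegrableOn b s μ) (a : 𝕜) :
    ‖a - ⨍ y in s, b y ∂μ‖ₑ ≤ (μ s)⁻¹ * ∫⁻ y in s, ‖a - b y‖ₑ ∂μ := by
  have hfin : IsFiniteMeasure (μ.restrict s) := ⟨by simpa using ht.lt_top⟩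
  have hr : μ.real s ≠ 0 := by simp [Measure.real, ENNReal.toReal_eq_zero_iff, h0, ht]
  have h1 : a - ⨍ y in s, b y ∂μ = (μ.real s)⁻¹ • ∫ y in s, (a - b y) ∂μ := by
    rw [setAverage_eq, integral_sub (integrable_const a) hb, smul_sub, setIntegral_const,
      smul_smul, inv_mul_cancel₀ hr, one_smul]
  rw [h1, enorm_smul]
  gcongr
  · rw [enorm_inv hr, Measure.real, Real.enorm_eq_ofReal ENNReal.toReal_nonneg,
      ENNReal.ofReal_toReal ht]
  · exact enorm_integral_le_lintegral_enorm _

end Average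

theorem two_rpow_lt_top (s : ℝ) : (2 : ℝ≥0∞) ^ s < ∞ :=
  lt_top_iff_ne_top.2 (by simp)

/-! ### Oscillation of `b` extracted from `M_b`, and the estimate for separated blocks. -/

section Estimates

variable {n : ℕ} {𝕜 : Type*} [RCLike 𝕜] {q : Fin n → ℝ}

/-- The average of `b` over the ball of radius `2 ^ k` centred at the origin. -/
def dyadicAverage (b : EuclideanSpace ℝ (Fin n) → 𝕜) (k : ℤ) : 𝕜 :=
  ⨍ z in closedBall 0 ((2 : ℝ) ^ k), b z

/-- `M_b` is bounded on `L^q(ℝⁿ)` with constant `C`. -/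
def MaximalCommutatorBound (q : Fin n → ℝ) (b : EuclideanSpace ℝ (Fin n) → 𝕜) (C : ℝ≥0) : Prop :=
  ∀ f : EuclideanSpace ℝ (Fin n) → 𝕜, MemMixedLp q f →
    MemMixedLp q (maximalCommutator b f) ∧
      mixedNorm q (maximalCommutator b f) ≤ (C : ℝ≥0∞) * mixedNorm q f

theorem maximalCommutator_mono {b f g : EuclideanSpace ℝ (Fin n) → 𝕜}
    (h : ∀ᵐ y, ‖f y‖ₑ ≤ ‖g y‖ₑ) (x : EuclideanSpace ℝ (Fin n)) :
    maximalCommutator b f x ≤ maximalCommutator b g x := by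
  refine iSup₂_mono fun r _ => ?_
  gcongr 1
  refine lintegral_mono_ae ((ae_restrict_of_ae h).mono fun y hy => ?_)
  gcongr

/-- The ball of radius `2 ^ (k + 1)` about a point of `B_k` contains all of `B_k`, hence the support
of `f`. -/
theorem lintegral_le_mul_maximalCommutator {b f : EuclideanSpace ℝ (Fin n) → 𝕜} {k : ℤ}
    (hf : ∀ y ∉ closedBall (0 : EuclideanSpace ℝ (Fin n)) ((2 : ℝ) ^ k), f y = 0)
    {x : EuclideanSpace ℝ (Fin n)} (hx : x ∈ closedBall 0 ((2 : ℝ) ^ k)) :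
    ∫⁻ y, ‖b x - b y‖ₑ * ‖f y‖ₑ ≤
      volume (closedBall x ((2 : ℝ) ^ (k + 1))) * maximalCommutator b f x := by
  have h1 : (volume (closedBall x ((2 : ℝ) ^ (k + 1))))⁻¹ *
      ∫⁻ y in closedBall x ((2 : ℝ) ^ (k + 1)), ‖b x - b y‖ₑ * ‖f y‖ₑ
        ≤ maximalCommutator b f x :=
    le_iSup₂_of_le ((2 : ℝ) ^ (k + 1)) (by positivity) le_rfl
  rw [← ENNReal.div_eq_inv_mul, ENNReal.div_le_iff_le_mul
    (Or.inl (volume_closedBall_two_zpow_ne_zero _ _))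
    (Or.inl measure_closedBall_lt_top.ne), mul_comm] at h1
  refine le_trans ?_ h1
  rw [← lintegral_indicator measurableSet_closedBall]
  refine lintegral_mono fun y => ?_
  by_cases hy : y ∈ closedBall x ((2 : ℝ) ^ (k + 1))
  · rw [Set.indicator_of_mem hy]
  · have : f y = 0 := by
      refine hf y fun hy' => hy ?_
      rw [mem_closedBall] at *
      have h2 : (2 : ℝ) ^ (k + 1) = 2 ^ k + 2 ^ k := by
        rw [zpow_add₀ two_ne_zero]; ring
      linarith [dist_triangle_right y x 0]
    simp [this]

/-- Testing `M_b` on the indicator of the ball recovers the oscillation of `b` pointwise; with the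
bound on `L^q` this stands in for John–Nirenberg. -/
theorem enorm_sub_dyadicAverage_le {b : EuclideanSpace ℝ (Fin n) → 𝕜}
    (hb : LocallyIntegrable b volume) {k : ℤ} {x : EuclideanSpace ℝ (Fin n)}
    (hx : x ∈ closedBall 0 ((2 : ℝ) ^ k)) :
    ‖b x - dyadicAverage b k‖ₑ ≤ (2 : ℝ≥0∞) ^ (n : ℝ) *
      maximalCommutator b ((closedBall 0 ((2 : ℝ) ^ k)).indicator 1) x := by
  have h0 := volume_closedBall_two_zpow_ne_zero (0 : EuclideanSpace ℝ (Fin n)) k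
  have ht : volume (closedBall (0 : EuclideanSpace ℝ (Fin n)) ((2 : ℝ) ^ k)) ≠ ∞ :=
    measure_closedBall_lt_top.ne
  refine (enorm_sub_setAverage_le h0 ht
    (hb.integrableOn_isCompact (isCompact_closedBall _ _)) (b x)).trans ?_
  have h := lintegral_le_mul_maximalCommutator (b := b)
    (f := (closedBall 0 ((2 : ℝ) ^ k)).indicator 1)
    (fun y hy => Set.indicator_of_notMem hy _) hx
  rw [volume_closedBall_two_zpow_add_one x 0 k, mul_comm ((2 : ℝ≥0∞) ^ (n : ℝ)), mul_assoc] at h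
  rw [← ENNReal.div_eq_inv_mul, ENNReal.div_le_iff_le_mul (Or.inl h0) (Or.inl ht), mul_comm]
  refine le_trans (le_of_eq ?_) h
  rw [← lintegral_indicator measurableSet_closedBall]
  refine lintegral_congr fun y => ?_
  by_cases hy : y ∈ closedBall (0 : EuclideanSpace ℝ (Fin n)) ((2 : ℝ) ^ k)
  · simp [Set.indicator_of_mem hy]
  · simp [Set.indicator_of_notMem hy]

theorem memMixedLp_indicator_closedBall_one (hq : ∀ i, 0 < q i) (k : ℤ) :
    MemMixedLp q ((closedBall (0 : EuclideanSpace ℝ (Fin n)) ((2 : ℝ) ^ k)).indicator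
      (1 : EuclideanSpace ℝ (Fin n) → 𝕜)) ∧
    mixedNorm q ((closedBall (0 : EuclideanSpace ℝ (Fin n)) ((2 : ℝ) ^ k)).indicator
      (1 : EuclideanSpace ℝ (Fin n) → 𝕜)) ≤ (2 : ℝ≥0∞) ^ (((k : ℝ) + 1) * ∑ i, 1 / q i) := by
  have h : mixedNorm q ((closedBall (0 : EuclideanSpace ℝ (Fin n)) ((2 : ℝ) ^ k)).indicator
      (1 : EuclideanSpace ℝ (Fin n) → 𝕜)) ≤ (2 : ℝ≥0∞) ^ (((k : ℝ) + 1) * ∑ i, 1 / q i) := by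
    refine (mixedNorm_mono hq fun x => ?_).trans (mixedNorm_closedBall_le hq k)
    rw [enorm_indicator_eq_indicator_enorm]
    simp [Set.indicator]
  refine ⟨⟨?_, h.trans_lt (two_rpow_lt_top _)⟩, h⟩
  exact (stronglyMeasurable_const.indicator measurableSet_closedBall).aestronglyMeasurable

theorem mixedNorm_sub_dyadicAverage_le (hq : ∀ i, 0 < q i)
    {b : EuclideanSpace ℝ (Fin n) → 𝕜} (hb : LocallyIntegrable b volume) {C : ℝ≥0}
    (hC : MaximalCommutatorBound q b C) (k : ℤ) :
    mixedNorm q ((closedBall 0 ((2 : ℝ) ^ k)).indicator fun x => ‖b x - dyadicAverage b k‖ₑ)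
      ≤ (2 : ℝ≥0∞) ^ (n : ℝ) * (C * (2 : ℝ≥0∞) ^ (((k : ℝ) + 1) * ∑ i, 1 / q i)) := by
  obtain ⟨hm, hn⟩ := memMixedLp_indicator_closedBall_one (𝕜 := 𝕜) hq k
  refine (mixedNorm_mono hq (g := fun x => (2 : ℝ≥0∞) ^ (n : ℝ) *
      maximalCommutator b ((closedBall 0 ((2 : ℝ) ^ k)).indicator 1) x) fun x => ?_).trans ?_
  · rw [enorm_eq_self, enorm_eq_self]
    by_cases hx : x ∈ closedBall (0 : EuclideanSpace ℝ (Fin n)) ((2 : ℝ) ^ k)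
    · rw [Set.indicator_of_mem hx]
      exact enorm_sub_dyadicAverage_le hb hx
    · rw [Set.indicator_of_notMem hx]
      exact zero_le
  · refine (mixedNorm_const_mul_le hq (by simp) _).trans ?_
    gcongr
    exact (hC _ hm).2.trans (by gcongr)

theorem lintegral_enorm_le (hq : ∀ i, 1 < q i) {f : EuclideanSpace ℝ (Fin n) → 𝕜}
    (hf : AEStronglyMeasurable f) {l : ℤ}
    (hs : ∀ y ∉ closedBall (0 : EuclideanSpace ℝ (Fin n)) ((2 : ℝ) ^ l), f y = 0) :
    ∫⁻ y, ‖f y‖ₑ ≤ (2 : ℝ≥0∞) ^ (((l : ℝ) + 1) * (n - ∑ i, 1 / q i)) * mixedNorm q f := by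
  refine le_trans ?_ (setLIntegral_closedBall_le hq l hf.enorm)
  rw [← lintegral_indicator measurableSet_closedBall]
  refine lintegral_mono fun y => ?_
  by_cases hy : y ∈ closedBall (0 : EuclideanSpace ℝ (Fin n)) ((2 : ℝ) ^ l)
  · rw [Set.indicator_of_mem hy]
  · simp [hs y hy]

/-- The substitute for an oscillation bound in the dual space: write the average as an integral over
`x ∈ B`, exchange the integrals, and recognise `M_b f (x)` up to `2 ^ n |B|`. Hölder on the ball
finishes. -/
theorem lintegral_sub_dyadicAverage_mul_le (hq : ∀ i, 1 < q i)
    {b : EuclideanSpace ℝ (Fin n) → 𝕜} (hb : LocallyIntegrable b volume) {C : ℝ≥0}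
    (hC : MaximalCommutatorBound q b C) {f : EuclideanSpace ℝ (Fin n) → 𝕜}
    (hf : MemMixedLp q f) {l : ℤ}
    (hs : ∀ y ∉ closedBall (0 : EuclideanSpace ℝ (Fin n)) ((2 : ℝ) ^ l), f y = 0) :
    ∫⁻ y, ‖b y - dyadicAverage b l‖ₑ * ‖f y‖ₑ ≤ (2 : ℝ≥0∞) ^ (n : ℝ) *
      ((2 : ℝ≥0∞) ^ (((l : ℝ) + 1) * (n - ∑ i, 1 / q i)) * (C * mixedNorm q f)) := by
  set B := closedBall (0 : EuclideanSpace ℝ (Fin n)) ((2 : ℝ) ^ l) with hB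
  have h0 : volume B ≠ 0 := volume_closedBall_two_zpow_ne_zero 0 l
  have ht : volume B ≠ ∞ := measure_closedBall_lt_top.ne
  have hbm : AEStronglyMeasurable b := hb.aestronglyMeasurable
  obtain ⟨hM, hMn⟩ := hC f hf
  have hprod : AEMeasurable (Function.uncurry fun y x => ‖b y - b x‖ₑ * ‖f y‖ₑ)
      ((volume : Measure (EuclideanSpace ℝ (Fin n))).prod (volume.restrict B)) := by
    have h1 : AEMeasurable (fun z : EuclideanSpace ℝ (Fin n) × EuclideanSpace ℝ (Fin n) =>
        ‖b z.1 - b z.2‖ₑ) (volume.prod (volume.restrict B)) :=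
      (hbm.comp_fst.sub (hbm.restrict).comp_snd).enorm
    have h2 : AEMeasurable (fun z : EuclideanSpace ℝ (Fin n) × EuclideanSpace ℝ (Fin n) =>
        ‖f z.1‖ₑ) (volume.prod (volume.restrict B)) := hf.1.comp_fst.enorm
    exact h1.mul h2
  calc ∫⁻ y, ‖b y - dyadicAverage b l‖ₑ * ‖f y‖ₑ
      ≤ ∫⁻ y, (volume B)⁻¹ * ∫⁻ x in B, ‖b y - b x‖ₑ * ‖f y‖ₑ := by
        refine lintegral_mono fun y => ?_
        rw [lintegral_mul_const' _ _ enorm_ne_top, ← mul_assoc]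
        gcongr
        exact enorm_sub_setAverage_le h0 ht
          (hb.integrableOn_isCompact (isCompact_closedBall _ _)) (b y)
    _ = (volume B)⁻¹ * ∫⁻ x in B, ∫⁻ y, ‖b y - b x‖ₑ * ‖f y‖ₑ := by
        rw [lintegral_const_mul' _ _ (ENNReal.inv_ne_top.2 h0), lintegral_lintegral_swap hprod]
    _ ≤ (volume B)⁻¹ * ∫⁻ x in B, (2 : ℝ≥0∞) ^ (n : ℝ) * volume B * maximalCommutator b f x := by
        gcongr 1
        refine setLIntegral_mono' measurableSet_closedBall fun x hx => ?_
        rw [hB, ← volume_closedBall_two_zpow_add_one x 0 l]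
        refine le_trans (le_of_eq (lintegral_congr fun y => ?_))
          (lintegral_le_mul_maximalCommutator hs hx)
        rw [← enorm_neg, neg_sub]
    _ = (2 : ℝ≥0∞) ^ (n : ℝ) * ∫⁻ x in B, maximalCommutator b f x := by
        rw [lintegral_const_mul' _ _ (ENNReal.mul_ne_top (by simp) ht), ← mul_assoc,
          mul_comm _ (volume B), ← mul_assoc, ENNReal.inv_mul_cancel h0 ht, one_mul]
    _ ≤ _ := by
        gcongr
        refine (setLIntegral_closedBall_le hq l hM.1.aemeasurable).trans ?_
        gcongr

/-- Enlarging the domain from `B_k` to `B_{k+1}` costs the volume ratio `2 ^ n`. -/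
theorem enorm_dyadicAverage_succ_sub_le {b : EuclideanSpace ℝ (Fin n) → 𝕜}
    (hb : LocallyIntegrable b volume) (k : ℤ) :
    ‖dyadicAverage b (k + 1) - dyadicAverage b k‖ₑ ≤ (2 : ℝ≥0∞) ^ (n : ℝ) * bmoSeminorm b := by
  have h0 := volume_closedBall_two_zpow_ne_zero (0 : EuclideanSpace ℝ (Fin n)) k
  have ht : volume (closedBall (0 : EuclideanSpace ℝ (Fin n)) ((2 : ℝ) ^ k)) ≠ ∞ :=
    measure_closedBall_lt_top.ne
  refine (enorm_sub_setAverage_le h0 ht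
    (hb.integrableOn_isCompact (isCompact_closedBall _ _)) _).trans ?_
  have h1 : (volume (closedBall (0 : EuclideanSpace ℝ (Fin n)) ((2 : ℝ) ^ (k + 1))))⁻¹ *
      ∫⁻ y in closedBall 0 ((2 : ℝ) ^ (k + 1)), ‖b y - dyadicAverage b (k + 1)‖ₑ
        ≤ bmoSeminorm b :=
    le_iSup_of_le 0 (le_iSup₂_of_le ((2 : ℝ) ^ (k + 1)) (by positivity) le_rfl)
  rw [← ENNReal.div_eq_inv_mul, ENNReal.div_le_iff_le_mul
    (Or.inl (volume_closedBall_two_zpow_ne_zero _ _))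
    (Or.inl measure_closedBall_lt_top.ne), volume_closedBall_two_zpow_add_one 0 0 k,
    ← mul_assoc, mul_comm (bmoSeminorm b)] at h1
  rw [← ENNReal.div_eq_inv_mul, ENNReal.div_le_iff_le_mul (Or.inl h0) (Or.inl ht)]
  refine le_trans ?_ h1
  refine le_trans (le_of_eq (lintegral_congr fun y => ?_)) (lintegral_mono_set
    (closedBall_subset_closedBall (zpow_le_zpow_right₀ one_le_two (by lia : k ≤ k + 1))))
  rw [← enorm_neg, neg_sub]

theorem enorm_dyadicAverage_sub_le {b : EuclideanSpace ℝ (Fin n) → 𝕜}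
    (hb : LocallyIntegrable b volume) (k l : ℤ) :
    ‖dyadicAverage b k - dyadicAverage b l‖ₑ ≤
      ((k - l).natAbs : ℝ≥0∞) * ((2 : ℝ≥0∞) ^ (n : ℝ) * bmoSeminorm b) := by
  have key : ∀ (j : ℕ) (l : ℤ), ‖dyadicAverage b (l + j) - dyadicAverage b l‖ₑ ≤
      (j : ℝ≥0∞) * ((2 : ℝ≥0∞) ^ (n : ℝ) * bmoSeminorm b) := by
    intro j l
    induction j with
    | zero => simp
    | succ j ih =>
      have h : dyadicAverage b (l + (j + 1 : ℕ)) - dyadicAverage b l =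
          (dyadicAverage b (l + j + 1) - dyadicAverage b (l + j)) +
            (dyadicAverage b (l + j) - dyadicAverage b l) := by
        push_cast
        rw [← add_assoc]
        ring
      rw [h]
      refine (enorm_add_le _ _).trans ?_
      push_cast
      rw [add_mul, one_mul, add_comm]
      gcongr
      exact enorm_dyadicAverage_succ_sub_le hb _
  rcases le_total l k with h | h
  · have := key (k - l).natAbs l
    rwa [show l + ((k - l).natAbs : ℤ) = k by lia] at this
  · have := key (k - l).natAbs k
    rwa [show k + ((k - l).natAbs : ℤ) = l by lia, ← enorm_neg, neg_sub] at this

/-- If `f` vanishes in the open ball of radius `2 ^ m` around `x`, then only balls of radius at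
least `2 ^ m` contribute to `M_b f (x)`. -/
theorem maximalCommutator_le_of_far {b f : EuclideanSpace ℝ (Fin n) → 𝕜} {m : ℤ}
    {x : EuclideanSpace ℝ (Fin n)} (h : ∀ y, f y ≠ 0 → (2 : ℝ) ^ m ≤ dist y x) :
    maximalCommutator b f x ≤ (volume (closedBall (0 : EuclideanSpace ℝ (Fin n))
      ((2 : ℝ) ^ m)))⁻¹ * ∫⁻ y, ‖b x - b y‖ₑ * ‖f y‖ₑ := by
  refine iSup₂_le fun r hr => ?_
  by_cases hrm : (2 : ℝ) ^ m ≤ r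
  · rw [← Measure.addHaar_closedBall_center volume x]
    gcongr
    exact Measure.restrict_le_self
  · have : ∫⁻ y in closedBall x r, ‖b x - b y‖ₑ * ‖f y‖ₑ = 0 := by
      rw [setLIntegral_congr_fun (g := 0) measurableSet_closedBall]
      · simp
      · intro y hy
        have : f y = 0 := by
          by_contra hne
          exact hrm ((h y hne).trans hy)
        simp [this]
    rw [this, mul_zero]
    exact zero_le

theorem mixedNorm_indicator_maximalCommutator_le_of_far (hq : ∀ i, 1 < q i)
    {b : EuclideanSpace ℝ (Fin n) → 𝕜} (hb : LocallyIntegrable b volume) {C : ℝ≥0}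
    (hC : MaximalCommutatorBound q b C) {f : EuclideanSpace ℝ (Fin n) → 𝕜}
    (hf : MemMixedLp q f) {k l m : ℤ}
    (hs : ∀ y ∉ closedBall (0 : EuclideanSpace ℝ (Fin n)) ((2 : ℝ) ^ l), f y = 0)
    {S : Set (EuclideanSpace ℝ (Fin n))} (hS : S ⊆ closedBall 0 ((2 : ℝ) ^ k))
    (hfar : ∀ x ∈ S, ∀ y, f y ≠ 0 → (2 : ℝ) ^ m ≤ dist y x) :
    mixedNorm q (S.indicator (maximalCommutator b f)) ≤
      (volume (closedBall (0 : EuclideanSpace ℝ (Fin n)) ((2 : ℝ) ^ m)))⁻¹ *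
      ((2 : ℝ≥0∞) ^ (((k : ℝ) + 1) * ∑ i, 1 / q i) *
        (2 : ℝ≥0∞) ^ (((l : ℝ) + 1) * (n - ∑ i, 1 / q i)) * (2 : ℝ≥0∞) ^ (n : ℝ) *
        (2 * C + (k - l).natAbs * bmoSeminorm b) * mixedNorm q f) := by
  have hq0 : ∀ i, 0 < q i := fun i => zero_lt_one.trans (hq i)
  have hbm : AEStronglyMeasurable b := hb.aestronglyMeasurable
  set B := closedBall (0 : EuclideanSpace ℝ (Fin n)) ((2 : ℝ) ^ k) with hB
  set V := (volume (closedBall (0 : EuclideanSpace ℝ (Fin n)) ((2 : ℝ) ^ m)))⁻¹ with hV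
  have hVt : V ≠ ∞ := ENNReal.inv_ne_top.2 (volume_closedBall_two_zpow_ne_zero _ _)
  set a := ∫⁻ y, ‖f y‖ₑ with ha
  -- `d` collects the contributions independent of `x`; the `x`-dependence is left to the
  -- oscillation `u` about the average over `B_k`.
  set d := ‖dyadicAverage b k - dyadicAverage b l‖ₑ * a +
    ∫⁻ y, ‖b y - dyadicAverage b l‖ₑ * ‖f y‖ₑ with hd
  have h1 := lintegral_enorm_le hq hf.1 hs
  have h2 := lintegral_sub_dyadicAverage_mul_le hq hb hC hf hs
  have h3 := enorm_dyadicAverage_sub_le hb k l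
  have h4 := mixedNorm_sub_dyadicAverage_le hq0 hb hC k
  have h5 := mixedNorm_closedBall_le hq0 k
  have hat : a ≠ ∞ := (h1.trans_lt (ENNReal.mul_lt_top
    (two_rpow_lt_top _) hf.2)).ne
  have hdt : d ≠ ∞ := by
    refine ENNReal.add_ne_top.2 ⟨ENNReal.mul_ne_top enorm_ne_top hat, ?_⟩
    refine (h2.trans_lt (ENNReal.mul_lt_top ?_ (ENNReal.mul_lt_top ?_
      (ENNReal.mul_lt_top ENNReal.coe_lt_top hf.2)))).ne <;>
    exact two_rpow_lt_top _
  set u : EuclideanSpace ℝ (Fin n) → ℝ≥0∞ := B.indicator fun x => ‖b x - dyadicAverage b k‖ₑ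
    with hu
  have hum : AEMeasurable u :=
    AEMeasurable.indicator (hbm.sub aestronglyMeasurable_const).enorm measurableSet_closedBall
  have hvm : AEMeasurable (B.indicator (1 : EuclideanSpace ℝ (Fin n) → ℝ≥0∞)) :=
    (measurable_one.indicator measurableSet_closedBall).aemeasurable
  have hpt : ∀ x, S.indicator (maximalCommutator b f) x ≤
      V * (a * u x + d * B.indicator (1 : EuclideanSpace ℝ (Fin n) → ℝ≥0∞) x) := by
    intro x
    by_cases hx : x ∈ S
    · rw [Set.indicator_of_mem hx, hu, Set.indicator_of_mem (hS hx), Set.indicator_of_mem (hS hx)]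
      refine (maximalCommutator_le_of_far (hfar x hx)).trans ?_
      gcongr
      have hfm : AEMeasurable (fun y => ‖f y‖ₑ) := hf.1.enorm
      calc ∫⁻ y, ‖b x - b y‖ₑ * ‖f y‖ₑ
          ≤ ∫⁻ y, ((‖b x - dyadicAverage b k‖ₑ + ‖dyadicAverage b k - dyadicAverage b l‖ₑ) *
              ‖f y‖ₑ + ‖b y - dyadicAverage b l‖ₑ * ‖f y‖ₑ) := by
            refine lintegral_mono fun y => ?_
            rw [← add_mul]
            gcongr
            have : b x - b y = ((b x - dyadicAverage b k) +
                (dyadicAverage b k - dyadicAverage b l)) + -(b y - dyadicAverage b l) := by ring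
            rw [this]
            refine (enorm_add_le _ _).trans ?_
            rw [enorm_neg]
            gcongr
            exact enorm_add_le _ _
        _ = _ := by
            rw [lintegral_add_left' (hfm.const_mul _), lintegral_const_mul' _ _
              (ENNReal.add_ne_top.2 ⟨enorm_ne_top, enorm_ne_top⟩), hd, Pi.one_apply, mul_one,
              mul_comm a, ← add_assoc, add_mul]
    · rw [Set.indicator_of_notMem hx]
      exact zero_le
  refine (mixedNorm_mono hq0 (g := fun x => V * (a * u x + d * B.indicator
    (1 : EuclideanSpace ℝ (Fin n) → ℝ≥0∞) x)) hpt).trans ?_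
  refine (mixedNorm_const_mul_le hq0 hVt _).trans ?_
  gcongr
  refine (mixedNorm_add_le (fun i => (hq i).le) (hum.const_mul _) (hvm.const_mul _)).trans ?_
  refine (add_le_add (mixedNorm_const_mul_le hq0 hat _)
    (mixedNorm_const_mul_le hq0 hdt _)).trans ?_
  -- Both oscillation terms, `h4` and `h2`, contribute one `C`; hence the `2 * C`.
  refine (add_le_add (mul_le_mul' h1 h4) (mul_le_mul' (add_le_add (mul_le_mul' h3 h1) h2)
    h5)).trans (le_of_eq ?_)
  ring

end Estimates

/-! ### Convolution on discrete Morrey spaces and summability of the kernel. -/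

section Sequences

theorem tsum_Iic_sub (d : ℤ → ℝ≥0∞) (k₀ j : ℤ) :
    ∑' k : Set.Iic k₀, d (k - j) = ∑' l : Set.Iic (k₀ - j), d l := by
  let e : Set.Iic k₀ ≃ Set.Iic (k₀ - j) :=
    (Equiv.subRight j).subtypeEquiv fun k => by simp
  exact e.tsum_eq (fun l : Set.Iic (k₀ - j) => d l)

theorem tsum_rpow_tsum_le {ι κ : Type*} [Countable ι] (F : ι → κ → ℝ≥0∞) {p : ℝ} (hp : 1 ≤ p) :
    (∑' k, (∑' i, F i k) ^ p) ^ (1 / p) ≤ ∑' i, (∑' k, F i k ^ p) ^ (1 / p) := by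
  let _ : MeasurableSpace κ := ⊤
  have h := lintegral_tsum_rpow_le (μ := (Measure.count : Measure κ)) (F := F) hp
    fun i => measurable_from_top.aemeasurable
  simpa only [lintegral_count' measurable_from_top] using h

/-- Convolution with a sequence `u` is bounded on discrete Morrey spaces, provided that `u` decays
fast enough. -/
theorem morrey_convolution_le {p lam : ℝ} (hp : 0 < p) (u a d : ℤ → ℝ≥0∞) (N : ℝ≥0∞)
    (ha : ∀ k, a k ≤ ∑' l, u (k - l) * d l)
    (hd : ∀ k₀ : ℤ, (∑' l : Set.Iic k₀, d l ^ p) ^ (1 / p) ≤ (2 : ℝ≥0∞) ^ ((k₀ : ℝ) * lam) * N)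
    (k₀ : ℤ) :
    (∑' k : Set.Iic k₀, a k ^ p) ^ (1 / p) ≤
      (2 : ℝ≥0∞) ^ ((k₀ : ℝ) * lam) * N *
        (∑' j : ℤ, (u j * (2 : ℝ≥0∞) ^ (-(j : ℝ) * lam)) ^ min p 1) ^ (1 / min p 1) := by
  have hp' : (0 : ℝ) ≤ 1 / p := by positivity
  have ha' : ∀ k, a k ≤ ∑' j, u j * d (k - j) := by
    intro k
    refine (ha k).trans (le_of_eq ?_)
    -- Reindex by the difference `j = k - l`.
    rw [← (Equiv.subLeft k).tsum_eq]
    simp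
  have hd' : ∀ j : ℤ, (∑' k : Set.Iic k₀, d (k - j) ^ p) ^ (1 / p) ≤
      (2 : ℝ≥0∞) ^ ((k₀ : ℝ) * lam) * N * (2 : ℝ≥0∞) ^ (-(j : ℝ) * lam) := by
    intro j
    rw [tsum_Iic_sub (fun l => d l ^ p) k₀ j]
    refine (hd (k₀ - j)).trans (le_of_eq ?_)
    rw [mul_right_comm, ← ENNReal.rpow_add _ _ (by simp) (by simp)]
    congr 2
    push_cast
    ring
  have h1 : (∑' k : Set.Iic k₀, a k ^ p) ^ (1 / p) ≤
      (∑' k : Set.Iic k₀, (∑' j, u j * d (k - j)) ^ p) ^ (1 / p) := by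
    gcongr
    exact ha' _
  refine h1.trans ?_
  -- For `p ≥ 1` use Minkowski with counting measure; for `p ≤ 1` move the power inside the sum and
  -- exchange the sums.
  rcases le_total 1 p with h | h
  · rw [min_eq_right h]
    simp only [ENNReal.rpow_one, div_one]
    refine (tsum_rpow_tsum_le (fun j (k : Set.Iic k₀) => u j * d (k - j)) h).trans ?_
    rw [← ENNReal.tsum_mul_left]
    refine ENNReal.tsum_le_tsum fun j => ?_
    simp_rw [ENNReal.mul_rpow_of_nonneg _ _ hp.le]
    rw [ENNReal.tsum_mul_left, ENNReal.mul_rpow_of_nonneg _ _ hp', ← ENNReal.rpow_mul,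
      mul_one_div_cancel hp.ne', ENNReal.rpow_one, mul_left_comm]
    gcongr
    exact hd' j
  · rw [min_eq_left h]
    have h2 : ∑' k : Set.Iic k₀, (∑' j, u j * d (k - j)) ^ p ≤
        ((2 : ℝ≥0∞) ^ ((k₀ : ℝ) * lam) * N) ^ p *
          ∑' j : ℤ, (u j * (2 : ℝ≥0∞) ^ (-(j : ℝ) * lam)) ^ p := by
      refine (ENNReal.tsum_le_tsum fun k => tsum_rpow_le_of_le_one _ hp h).trans ?_
      rw [ENNReal.tsum_comm, ← ENNReal.tsum_mul_left]
      refine ENNReal.tsum_le_tsum fun j => ?_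
      simp_rw [ENNReal.mul_rpow_of_nonneg (u j) _ hp.le]
      rw [ENNReal.tsum_mul_left, mul_left_comm]
      gcongr
      rw [← ENNReal.mul_rpow_of_nonneg _ _ hp.le]
      have := ENNReal.rpow_le_rpow (hd' j) hp.le
      rwa [← ENNReal.rpow_mul, one_div_mul_cancel hp.ne', ENNReal.rpow_one] at this
    refine (ENNReal.rpow_le_rpow h2 hp').trans (le_of_eq ?_)
    rw [ENNReal.mul_rpow_of_nonneg _ _ hp', ← ENNReal.rpow_mul,
      mul_one_div_cancel hp.ne', ENNReal.rpow_one]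

/-- The decay of the interaction between the dyadic blocks `k` and `k - j`. -/
def blockWeight (n : ℕ) (σ : ℝ) (j : ℤ) : ℝ≥0∞ :=
  ((j.natAbs : ℝ≥0∞) + 1) * (2 : ℝ≥0∞) ^ (-(max (j : ℝ) 0) * n + j * σ)

theorem tsum_natAbs_mul_geometric_lt_top {δ : ℝ} (hδ : 0 < δ) :
    ∑' j : ℤ, ((j.natAbs : ℝ≥0∞) + 1) * (2 : ℝ≥0∞) ^ (-(j.natAbs : ℝ) * δ) < ∞ := by
  set r : ℝ := (2 : ℝ) ^ (-δ) with hr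
  have hr0 : 0 < r := by positivity
  have hr1 : r < 1 := Real.rpow_lt_one_of_one_lt_of_neg one_lt_two (by linarith)
  have hs : Summable fun m : ℕ => ((m : ℝ) + 1) * r ^ m := by
    have h1 := summable_pow_mul_geometric_of_norm_lt_one (R := ℝ) 1
      (show ‖r‖ < 1 by rwa [Real.norm_of_nonneg hr0.le])
    have h2 := summable_geometric_of_lt_one hr0.le hr1
    simpa [add_mul] using h1.add h2
  have hz : Summable fun j : ℤ => ((j.natAbs : ℝ) + 1) * r ^ j.natAbs := by
    refine Summable.of_nat_of_neg ?_ ?_ <;> simpa using hs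
  have h := hz.tsum_ofReal_ne_top
  refine lt_top_iff_ne_top.2 ?_
  convert h using 4 with j
  rw [ENNReal.ofReal_mul (by positivity), ENNReal.ofReal_pow hr0.le, hr,
    ← ENNReal.ofReal_rpow_of_pos two_pos, ENNReal.ofReal_add (by positivity) zero_le_one]
  simp only [ENNReal.ofReal_natCast, ENNReal.ofReal_one, ENNReal.ofReal_ofNat]
  rw [← ENNReal.rpow_natCast, ← ENNReal.rpow_mul]
  congr 2
  ring

theorem tsum_blockWeight_lt_top {n : ℕ} {σ α lam : ℝ} (h1 : lam - σ < α)
    (h2 : α < n - σ) (hlam : 0 ≤ lam) {K : ℝ≥0∞} (hK : K ≠ ∞) {s : ℝ} (hs : 0 < s) (hs1 : s ≤ 1) :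
    ∑' j : ℤ, (K * blockWeight n σ j * (2 : ℝ≥0∞) ^ ((j : ℝ) * α) *
      (2 : ℝ≥0∞) ^ (-(j : ℝ) * lam)) ^ s < ∞ := by
  -- The decay rates of the kernel at `+∞` and at `-∞`.
  set δ := min (n - σ - α + lam) (σ + α - lam) with hδ
  have hδ0 : 0 < δ := lt_min (by linarith) (by linarith)
  have key : ∀ j : ℤ, (K * blockWeight n σ j * (2 : ℝ≥0∞) ^ ((j : ℝ) * α) *
      (2 : ℝ≥0∞) ^ (-(j : ℝ) * lam)) ^ s ≤
      K ^ s * (((j.natAbs : ℝ≥0∞) + 1) * (2 : ℝ≥0∞) ^ (-(j.natAbs : ℝ) * (δ * s))) := by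
    intro j
    have e1 : K * blockWeight n σ j * (2 : ℝ≥0∞) ^ ((j : ℝ) * α) *
        (2 : ℝ≥0∞) ^ (-(j : ℝ) * lam) = K * (((j.natAbs : ℝ≥0∞) + 1) *
          (2 : ℝ≥0∞) ^ (-(max (j : ℝ) 0) * n + j * σ + j * α + -j * lam)) := by
      rw [blockWeight, ENNReal.rpow_add (_ + _) _ (by simp) (by simp),
        ENNReal.rpow_add (-(max (j : ℝ) 0) * n + j * σ) _ (by simp) (by simp)]
      ring
    have e2 : -(max (j : ℝ) 0) * n + j * σ + j * α + -j * lam ≤ -(j.natAbs : ℝ) * δ := by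
      have hc : (j.natAbs : ℝ) = |(j : ℝ)| := by rw [Nat.cast_natAbs, Int.cast_abs]
      rw [hc]
      rcases le_total 0 (j : ℝ) with hj | hj
      · rw [max_eq_left hj, abs_of_nonneg hj]
        nlinarith [min_le_left (n - σ - α + lam) (σ + α - lam)]
      · rw [max_eq_right hj, abs_of_nonpos hj]
        nlinarith [min_le_right (n - σ - α + lam) (σ + α - lam)]
    rw [e1, ENNReal.mul_rpow_of_nonneg _ _ hs.le, ENNReal.mul_rpow_of_nonneg _ _ hs.le,
      ← ENNReal.rpow_mul]
    refine mul_le_mul' le_rfl (mul_le_mul' ?_ ?_)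
    · refine (ENNReal.rpow_le_rpow_of_exponent_le le_add_self hs1).trans ?_
      rw [ENNReal.rpow_one]
    · refine ENNReal.rpow_le_rpow_of_exponent_le one_le_two ?_
      rw [← mul_assoc]
      gcongr
  refine (ENNReal.tsum_le_tsum key).trans_lt ?_
  rw [ENNReal.tsum_mul_left]
  exact ENNReal.mul_lt_top (ENNReal.rpow_lt_top_of_nonneg hs.le hK)
    (tsum_natAbs_mul_geometric_lt_top (by positivity))

end Sequences

/-! ### Splitting `f` into annuli and the block estimate. -/

section Decomposition

variable {n : ℕ} {𝕜 : Type*} [RCLike 𝕜] {q : Fin n → ℝ}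

theorem mem_annulus {k : ℤ} {x : EuclideanSpace ℝ (Fin n)} :
    x ∈ annulus n k ↔ ‖x‖ ≤ (2 : ℝ) ^ k ∧ (2 : ℝ) ^ (k - 1) < ‖x‖ := by
  simp [annulus]

theorem measurableSet_annulus (k : ℤ) : MeasurableSet (annulus n k) :=
  measurableSet_closedBall.diff measurableSet_closedBall

theorem exists_mem_annulus {x : EuclideanSpace ℝ (Fin n)} (hx : x ≠ 0) :
    ∃ k, x ∈ annulus n k := by
  obtain ⟨k, hk⟩ := exists_mem_Ioc_zpow (norm_pos_iff.2 hx) one_lt_two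
  refine ⟨k + 1, mem_annulus.2 ⟨hk.2, ?_⟩⟩
  simpa using hk.1

theorem maximalCommutator_le_tsum {ι : Type*} [Countable ι]
    {b f : EuclideanSpace ℝ (Fin n) → 𝕜} (hb : AEStronglyMeasurable b)
    {F : ι → EuclideanSpace ℝ (Fin n) → 𝕜} (hF : ∀ i, AEStronglyMeasurable (F i))
    (h : ∀ᵐ y, ‖f y‖ₑ ≤ ∑' i, ‖F i y‖ₑ) (x : EuclideanSpace ℝ (Fin n)) :
    maximalCommutator b f x ≤ ∑' i, maximalCommutator b (F i) x := by
  refine iSup₂_le fun r hr => ?_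
  have h1 : ∫⁻ y in closedBall x r, ‖b x - b y‖ₑ * ‖f y‖ₑ ≤
      ∑' i, ∫⁻ y in closedBall x r, ‖b x - b y‖ₑ * ‖F i y‖ₑ := by
    have hm : ∀ i, AEMeasurable (fun y => ‖b x - b y‖ₑ * ‖F i y‖ₑ)
        (volume.restrict (closedBall x r)) := fun i =>
      ((aestronglyMeasurable_const.sub hb).enorm.mul (hF i).enorm).restrict
    rw [← lintegral_tsum hm]
    refine lintegral_mono_ae ((ae_restrict_of_ae h).mono fun y hy => ?_)
    rw [ENNReal.tsum_mul_left]
    gcongr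
  refine (mul_le_mul' le_rfl h1).trans ?_
  rw [← ENNReal.tsum_mul_left]
  exact ENNReal.tsum_le_tsum fun i => le_iSup₂_of_le r hr le_rfl

theorem maximalCommutator_le_add {b f g h : EuclideanSpace ℝ (Fin n) → 𝕜}
    (hb : AEStronglyMeasurable b) (hg : AEStronglyMeasurable g) (hh : AEStronglyMeasurable h)
    (hf : ∀ y, ‖f y‖ₑ ≤ ‖g y‖ₑ + ‖h y‖ₑ) (x : EuclideanSpace ℝ (Fin n)) :
    maximalCommutator b f x ≤ maximalCommutator b g x + maximalCommutator b h x := by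
  have := maximalCommutator_le_tsum (f := f) (F := fun i : Bool => bif i then g else h) hb
    (by rintro (_ | _) <;> assumption)
    (Filter.Eventually.of_forall fun y => by simpa [tsum_fintype] using hf y) x
  simpa [tsum_fintype] using this

/-- The annuli miss the origin, which is a null set only when `n ≥ 1`. -/
theorem maximalCommutator_le_tsum_annulus (hn : 1 ≤ n)
    {b f : EuclideanSpace ℝ (Fin n) → 𝕜} (hb : AEStronglyMeasurable b)
    (hf : AEStronglyMeasurable f) (x : EuclideanSpace ℝ (Fin n)) :
    maximalCommutator b f x ≤ ∑' l, maximalCommutator b ((annulus n l).indicator f) x := by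
  have : Nonempty (Fin n) := ⟨⟨0, hn⟩⟩
  refine maximalCommutator_le_tsum hb (fun l => hf.indicator (measurableSet_annulus l)) ?_ x
  have h0 : ∀ᵐ y : EuclideanSpace ℝ (Fin n), y ≠ 0 := by
    simp [ae_iff, measure_singleton]
  filter_upwards [h0] with y hy
  obtain ⟨k, hk⟩ := exists_mem_annulus hy
  refine le_trans (le_of_eq ?_) (ENNReal.le_tsum k)
  rw [Set.indicator_of_mem hk]

/-- Source of measurability: for `f` in `L^q_loc` each truncation is in `L^q`, where the hypothesis
makes `M_b` measurable. -/
theorem maximalCommutator_eq_iSup (b f : EuclideanSpace ℝ (Fin n) → 𝕜)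
    (x : EuclideanSpace ℝ (Fin n)) :
    maximalCommutator b f x = ⨆ j : ℕ,
      maximalCommutator b ((closedBall 0 ((2 : ℝ) ^ (j : ℤ))).indicator f) x := by
  refine le_antisymm (iSup₂_le fun r hr => ?_) (iSup_le fun j => maximalCommutator_mono
    (Filter.Eventually.of_forall fun y => enorm_indicator_le_enorm_self f y) x)
  obtain ⟨j, hj⟩ := pow_unbounded_of_one_lt (r + ‖x‖) one_lt_two
  refine le_iSup_of_le j (le_iSup₂_of_le r hr (le_of_eq ?_))
  congr 1
  refine setLIntegral_congr_fun measurableSet_closedBall fun y hy => ?_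
  have : y ∈ closedBall (0 : EuclideanSpace ℝ (Fin n)) ((2 : ℝ) ^ (j : ℤ)) := by
    rw [mem_closedBall] at hy
    rw [mem_closedBall, zpow_natCast]
    have := dist_triangle y x 0
    rw [dist_zero_right x] at this
    linarith
  simp only [Set.indicator_of_mem this]

theorem sum_one_div_le (hq : ∀ i, 1 < q i) : ∑ i, 1 / q i ≤ n := by
  have : ∑ i, 1 / q i ≤ ∑ _i : Fin n, (1 : ℝ) := Finset.sum_le_sum fun i _ => by
    rw [div_le_one (by linarith [hq i])]
    exact (hq i).le
  simpa using this

theorem sum_one_div_nonneg (hq : ∀ i, 1 < q i) : 0 ≤ ∑ i, 1 / q i :=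
  Finset.sum_nonneg fun i _ => by
    have := hq i
    positivity

theorem two_rpow_neg_le_blockWeight (hq : ∀ i, 1 < q i) {j : ℤ} (hj : |j| ≤ 1) :
    (2 : ℝ≥0∞) ^ (-(n : ℝ)) ≤ blockWeight n (∑ i, 1 / q i) j := by
  have h0 := sum_one_div_nonneg hq
  have h1 := sum_one_div_le hq
  have hn : (0 : ℝ) ≤ n := by positivity
  rw [blockWeight, ← one_mul ((2 : ℝ≥0∞) ^ (-(n : ℝ)))]
  refine mul_le_mul' le_add_self (ENNReal.rpow_le_rpow_of_exponent_le one_le_two ?_)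
  obtain ⟨h2, h3⟩ := abs_le.1 hj
  generalize ∑ i, 1 / q i = σ at h0 h1
  interval_cases j <;> simp <;> linarith

theorem dist_lower_bound {k l : ℤ} {x y : EuclideanSpace ℝ (Fin n)}
    (hx : x ∈ closedBall 0 ((2 : ℝ) ^ k)) (hy : y ∈ annulus n l)
    (h : k + 2 ≤ l ∨ l + 2 ≤ k ∧ x ∈ annulus n k) : (2 : ℝ) ^ (max k l - 2) ≤ dist y x := by
  rw [mem_closedBall_zero_iff] at hx
  obtain ⟨hy1, hy2⟩ := mem_annulus.1 hy
  have hz : ∀ m : ℤ, (2 : ℝ) ^ (m - 1) = 2 * 2 ^ (m - 2) := fun m => by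
    rw [show m - 1 = 1 + (m - 2) by ring, zpow_add₀ two_ne_zero, zpow_one]
  rcases h with h | ⟨h, hx'⟩
  · have h1 : (2 : ℝ) ^ k ≤ 2 ^ (l - 2) := zpow_le_zpow_right₀ one_le_two (by lia)
    rw [max_eq_right (by lia), dist_eq_norm]
    have := norm_sub_norm_le y x
    linarith [hz l]
  · have h1 : (2 : ℝ) ^ l ≤ 2 ^ (k - 2) := zpow_le_zpow_right₀ one_le_two (by lia)
    rw [max_eq_left (by lia), dist_comm, dist_eq_norm]
    have := norm_sub_norm_le x y
    linarith [hz k, (mem_annulus.1 hx').2]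

/-- The constant in the dyadic block estimate. -/
def blockConst (C : ℝ≥0) (b : EuclideanSpace ℝ (Fin n) → 𝕜) : ℝ≥0∞ :=
  (2 : ℝ≥0∞) ^ (n : ℝ) * C + (volume (ball (0 : EuclideanSpace ℝ (Fin n)) 1))⁻¹ *
    (2 : ℝ≥0∞) ^ (4 * (n : ℝ)) * (2 * C + bmoSeminorm b)

theorem blockConst_ne_top {C : ℝ≥0} {b : EuclideanSpace ℝ (Fin n) → 𝕜}
    (hb : bmoSeminorm b < ∞) : blockConst C b ≠ ∞ := by
  have h : volume (ball (0 : EuclideanSpace ℝ (Fin n)) 1) ≠ 0 :=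
    (measure_ball_pos volume _ one_pos).ne'
  refine ENNReal.add_ne_top.2 ⟨ENNReal.mul_ne_top (two_rpow_lt_top _).ne ENNReal.coe_ne_top,
    ENNReal.mul_ne_top (ENNReal.mul_ne_top (ENNReal.inv_ne_top.2 h) (two_rpow_lt_top _).ne)
      (ENNReal.add_ne_top.2 ⟨ENNReal.mul_ne_top (by simp) ENNReal.coe_ne_top, hb.ne⟩)⟩

/-- Exponent count, using `max k l - l = max (k - l) 0`; the shifts by 1 and 2 add up to `4 n`. -/
theorem far_constant_le (σ : ℝ) (C : ℝ≥0) (b : EuclideanSpace ℝ (Fin n) → 𝕜)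
    (k l : ℤ) :
    (volume (closedBall (0 : EuclideanSpace ℝ (Fin n)) ((2 : ℝ) ^ (max k l - 2))))⁻¹ *
      ((2 : ℝ≥0∞) ^ (((k : ℝ) + 1) * σ) *
        (2 : ℝ≥0∞) ^ (((l : ℝ) + 1) * (n - σ)) * (2 : ℝ≥0∞) ^ (n : ℝ) *
        (2 * C + (k - l).natAbs * bmoSeminorm b)) ≤
      blockConst C b * blockWeight n σ (k - l) := by
  set ω := volume (ball (0 : EuclideanSpace ℝ (Fin n)) 1)
  have h1 : (2 * C + (k - l).natAbs * bmoSeminorm b : ℝ≥0∞) ≤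
      (2 * C + bmoSeminorm b) * (((k - l).natAbs : ℝ≥0∞) + 1) := by
    rw [add_mul, mul_comm (bmoSeminorm b)]
    refine add_le_add (le_mul_of_one_le_right' le_add_self) ?_
    gcongr
    exact le_self_add
  have h2 : (volume (closedBall (0 : EuclideanSpace ℝ (Fin n)) ((2 : ℝ) ^ (max k l - 2))))⁻¹ =
      (2 : ℝ≥0∞) ^ (-(((max k l - 2 : ℤ) : ℝ) * n)) * ω⁻¹ := by
    rw [volume_closedBall_two_zpow, ENNReal.mul_inv (by simp) (by simp), ENNReal.rpow_neg]
  have h3 : (2 : ℝ≥0∞) ^ (-(((max k l - 2 : ℤ) : ℝ) * n)) * ((2 : ℝ≥0∞) ^ (((k : ℝ) + 1) * σ) *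
      (2 : ℝ≥0∞) ^ (((l : ℝ) + 1) * (n - σ)) * (2 : ℝ≥0∞) ^ (n : ℝ)) =
      (2 : ℝ≥0∞) ^ (4 * (n : ℝ)) *
        (2 : ℝ≥0∞) ^ (-(max ((k - l : ℤ) : ℝ) 0) * n + (k - l : ℤ) * σ) := by
    simp only [← ENNReal.rpow_add _ _ two_ne_zero ENNReal.ofNat_ne_top]
    congr 1
    push_cast
    rcases le_total (k : ℝ) l with h | h
    · rw [max_eq_right h, max_eq_right (by linarith)]
      ring
    · rw [max_eq_left h, max_eq_left (by linarith)]
      ring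
  rw [h2]
  calc _ = ω⁻¹ * ((2 : ℝ≥0∞) ^ (-(((max k l - 2 : ℤ) : ℝ) * n)) *
        ((2 : ℝ≥0∞) ^ (((k : ℝ) + 1) * σ) * (2 : ℝ≥0∞) ^ (((l : ℝ) + 1) * (n - σ)) *
        (2 : ℝ≥0∞) ^ (n : ℝ))) * (2 * C + (k - l).natAbs * bmoSeminorm b) := by ring
    _ ≤ ω⁻¹ * ((2 : ℝ≥0∞) ^ (4 * (n : ℝ)) *
        (2 : ℝ≥0∞) ^ (-(max ((k - l : ℤ) : ℝ) 0) * n + (k - l : ℤ) * σ)) *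
        ((2 * C + bmoSeminorm b) * (((k - l).natAbs : ℝ≥0∞) + 1)) := by
      rw [h3]
      gcongr
    _ = (ω⁻¹ * (2 : ℝ≥0∞) ^ (4 * (n : ℝ)) * (2 * C + bmoSeminorm b)) *
        blockWeight n σ (k - l) := by
      rw [blockWeight]
      ring
    _ ≤ _ := by
      gcongr
      exact le_add_self

/-- The first alternative in `hfar` serves the Herz–Morrey norm. The second lets `S` be a whole ball
around the origin, as local integrability requires; separated blocks then have `l ≥ k + 2`. -/
theorem mixedNorm_indicator_maximalCommutator_block_le (hq : ∀ i, 1 < q i)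
    {b : EuclideanSpace ℝ (Fin n) → 𝕜} (hb : LocallyIntegrable b volume) {C : ℝ≥0}
    (hC : MaximalCommutatorBound q b C) {f : EuclideanSpace ℝ (Fin n) → 𝕜}
    (hf : MemMixedLp q f) {k l : ℤ} (hs : ∀ y, f y ≠ 0 → y ∈ annulus n l)
    {S : Set (EuclideanSpace ℝ (Fin n))} (hS : S ⊆ closedBall 0 ((2 : ℝ) ^ k))
    (hfar : S ⊆ annulus n k ∨ ∀ y ∈ closedBall 0 ((2 : ℝ) ^ (k + 1)), f y = 0) :
    mixedNorm q (S.indicator (maximalCommutator b f)) ≤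
      blockConst C b * blockWeight n (∑ i, 1 / q i) (k - l) * mixedNorm q f := by
  have hq0 : ∀ i, 0 < q i := fun i => zero_lt_one.trans (hq i)
  by_cases hnear : |k - l| ≤ 1
  · refine (mixedNorm_mono hq0 (g := maximalCommutator b f)
      fun x => enorm_indicator_le_enorm_self _ x).trans ((hC f hf).2.trans ?_)
    gcongr
    calc (C : ℝ≥0∞) = (2 : ℝ≥0∞) ^ (n : ℝ) * C * (2 : ℝ≥0∞) ^ (-(n : ℝ)) := by
          rw [mul_right_comm, ← ENNReal.rpow_add _ _ (by simp) (by simp)]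
          simp
      _ ≤ _ := mul_le_mul' le_self_add (two_rpow_neg_le_blockWeight hq hnear)
  · refine (mixedNorm_indicator_maximalCommutator_le_of_far (k := k) (l := l)
      (m := max k l - 2) hq hb hC hf (fun y hy => ?_) hS fun x hx y hy => ?_).trans ?_
    · by_contra hne
      exact hy (hs y hne).1
    · refine dist_lower_bound (hS hx) (hs y hy) ?_
      rcases hfar with h | h
      · rcases le_total k l with hkl | hkl
        · left
          rw [abs_of_nonpos (by lia)] at hnear
          lia
        · right
          rw [abs_of_nonneg (by lia)] at hnear
          exact ⟨by lia, h hx⟩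
      · left
        by_contra hlt
        refine hy (h y (closedBall_subset_closedBall ?_ (hs y hy).1))
        exact zpow_le_zpow_right₀ one_le_two (by lia)
    · rw [← mul_assoc]
      refine mul_le_mul' ?_ le_rfl
      exact far_constant_le _ C b k l

theorem mixedNorm_indicator_maximalCommutator_le_tsum (hn : 1 ≤ n) (hq : ∀ i, 1 < q i)
    {b : EuclideanSpace ℝ (Fin n) → 𝕜} (hb : LocallyIntegrable b volume) {C : ℝ≥0}
    (hC : MaximalCommutatorBound q b C) {f : EuclideanSpace ℝ (Fin n) → 𝕜}
    (hf : AEStronglyMeasurable f) (hfl : ∀ l, MemMixedLp q ((annulus n l).indicator f)) {k : ℤ}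
    {S : Set (EuclideanSpace ℝ (Fin n))} (hSm : MeasurableSet S)
    (hS : S ⊆ closedBall 0 ((2 : ℝ) ^ k))
    (hfar : S ⊆ annulus n k ∨ ∀ y ∈ closedBall 0 ((2 : ℝ) ^ (k + 1)), f y = 0) :
    mixedNorm q (S.indicator (maximalCommutator b f)) ≤
      ∑' l, blockConst C b * blockWeight n (∑ i, 1 / q i) (k - l) *
        mixedNorm q ((annulus n l).indicator f) := by
  have hq0 : ∀ i, 0 < q i := fun i => zero_lt_one.trans (hq i)
  have h1 : mixedNorm q (S.indicator (maximalCommutator b f)) ≤ mixedNorm q (fun x =>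
      ∑' l, S.indicator (maximalCommutator b ((annulus n l).indicator f)) x) := by
    refine mixedNorm_mono hq0 fun x => ?_
    rw [enorm_eq_self, enorm_eq_self]
    by_cases hx : x ∈ S
    · simp only [Set.indicator_of_mem hx]
      exact maximalCommutator_le_tsum_annulus hn hb.aestronglyMeasurable hf x
    · simp only [Set.indicator_of_notMem hx]
      exact zero_le
  refine h1.trans ((mixedNorm_tsum_le (fun i => (hq i).le) fun l =>
    ((hC _ (hfl l)).1.1.aemeasurable.indicator hSm)).trans (ENNReal.tsum_le_tsum fun l => ?_))
  refine mixedNorm_indicator_maximalCommutator_block_le hq hb hC (hfl l) (fun y hy => ?_) hS ?_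
  · exact Set.mem_of_indicator_ne_zero hy
  · refine hfar.imp_right fun h y hy => ?_
    by_cases hyl : y ∈ annulus n l
    · rw [Set.indicator_of_mem hyl, h y hy]
    · rw [Set.indicator_of_notMem hyl]

theorem MemMixedLp.mono_set {E : Type*} [NormedAddCommGroup E] (hq : ∀ i, 0 < q i)
    {f : EuclideanSpace ℝ (Fin n) → E} (hf : AEStronglyMeasurable f)
    {s t : Set (EuclideanSpace ℝ (Fin n))} (hs : MeasurableSet s) (hst : s ⊆ t)
    (ht : MemMixedLp q (t.indicator f)) : MemMixedLp q (s.indicator f) := by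
  refine ⟨hf.indicator hs, (mixedNorm_mono hq fun x => ?_).trans_lt ht.2⟩
  rw [enorm_indicator_eq_indicator_enorm, enorm_indicator_eq_indicator_enorm]
  exact Set.indicator_le_indicator_of_subset hst (fun _ => zero_le) x

end Decomposition

/-! ### Herz–Morrey norms of block sequences and local integrability of `M_b f`. -/

section HerzMorreyBound

variable {n : ℕ} {𝕜 : Type*} [RCLike 𝕜] {q : Fin n → ℝ}

theorem MemMixedLpLoc.annulus (hq : ∀ i, 0 < q i) {f : EuclideanSpace ℝ (Fin n) → 𝕜}
    (hf : MemMixedLpLoc q f) (l : ℤ) : MemMixedLp q ((annulus n l).indicator f) :=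
  MemMixedLp.mono_set hq hf.1 (measurableSet_annulus l) Set.sdiff_subset
    (hf.2 _ (isCompact_closedBall 0 ((2 : ℝ) ^ l)))

theorem tsum_rpow_le_of_herzMorreyNorm {E : Type*} [TopologicalSpace E] [ESeminormedAddMonoid E]
    {α lam p : ℝ} (hp : 0 < p) (f : EuclideanSpace ℝ (Fin n) → E) (k₀ : ℤ) :
    (∑' k : Set.Iic k₀, ((2 : ℝ≥0∞) ^ (((k : ℤ) : ℝ) * α) *
      mixedNorm q ((annulus n k).indicator f)) ^ p) ^ (1 / p) ≤
      (2 : ℝ≥0∞) ^ ((k₀ : ℝ) * lam) * herzMorreyNorm α lam p q f := by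
  have h : (2 : ℝ≥0∞) ^ (-(k₀ : ℝ) * lam) * (∑' k : Set.Iic k₀,
      (2 : ℝ≥0∞) ^ (((k : ℤ) : ℝ) * α * p) *
      mixedNorm q ((annulus n k).indicator f) ^ p) ^ (1 / p) ≤ herzMorreyNorm α lam p q f :=
    le_iSup (fun k₀ : ℤ => (2 : ℝ≥0∞) ^ (-(k₀ : ℝ) * lam) * (∑' k : Set.Iic k₀,
      (2 : ℝ≥0∞) ^ (((k : ℤ) : ℝ) * α * p) *
      mixedNorm q ((annulus n k).indicator f) ^ p) ^ (1 / p)) k₀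
  refine le_trans (le_of_eq ?_) (mul_le_mul' le_rfl h)
  rw [← mul_assoc, ← ENNReal.rpow_add _ _ (by simp) (by simp)]
  simp_rw [ENNReal.mul_rpow_of_nonneg _ _ hp.le, ← ENNReal.rpow_mul]
  simp

theorem herzMorreyNorm_le {E : Type*} [TopologicalSpace E] [ESeminormedAddMonoid E]
    {α lam p : ℝ} (hp : 0 < p) (f : EuclideanSpace ℝ (Fin n) → E) {N : ℝ≥0∞}
    (h : ∀ k₀ : ℤ, (∑' k : Set.Iic k₀, ((2 : ℝ≥0∞) ^ (((k : ℤ) : ℝ) * α) *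
      mixedNorm q ((annulus n k).indicator f)) ^ p) ^ (1 / p) ≤
      (2 : ℝ≥0∞) ^ ((k₀ : ℝ) * lam) * N) : herzMorreyNorm α lam p q f ≤ N := by
  refine iSup_le fun k₀ => ?_
  refine le_trans (mul_le_mul' le_rfl (le_trans (le_of_eq ?_) (h k₀))) (le_of_eq ?_)
  · simp_rw [ENNReal.mul_rpow_of_nonneg _ _ hp.le, ← ENNReal.rpow_mul]
  · rw [← mul_assoc, ← ENNReal.rpow_add _ _ (by simp) (by simp)]
    simp

theorem mixedNorm_annulus_le {E : Type*} [TopologicalSpace E] [ESeminormedAddMonoid E]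
    {α lam p : ℝ} (hp : 0 < p) (f : EuclideanSpace ℝ (Fin n) → E) (l : ℤ) :
    (2 : ℝ≥0∞) ^ ((l : ℝ) * α) * mixedNorm q ((annulus n l).indicator f) ≤
      (2 : ℝ≥0∞) ^ ((l : ℝ) * lam) * herzMorreyNorm α lam p q f := by
  refine le_trans ?_ (tsum_rpow_le_of_herzMorreyNorm hp f l)
  have h := ENNReal.rpow_le_rpow (ENNReal.le_tsum (f := fun k : Set.Iic l =>
    ((2 : ℝ≥0∞) ^ (((k : ℤ) : ℝ) * α) * mixedNorm q ((annulus n k).indicator f)) ^ p)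
    ⟨l, Set.mem_Iic.2 le_rfl⟩) (show 0 ≤ 1 / p by positivity)
  refine le_trans (le_of_eq ?_) h
  rw [← ENNReal.rpow_mul, mul_one_div_cancel hp.ne', ENNReal.rpow_one]

theorem aemeasurable_maximalCommutator {b : EuclideanSpace ℝ (Fin n) → 𝕜} {C : ℝ≥0}
    (hC : MaximalCommutatorBound q b C) {f : EuclideanSpace ℝ (Fin n) → 𝕜}
    (hf : MemMixedLpLoc q f) : AEMeasurable (maximalCommutator b f) := by
  rw [funext (maximalCommutator_eq_iSup b f)]
  exact AEMeasurable.iSup fun j =>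
    (hC _ (hf.2 _ (isCompact_closedBall 0 ((2 : ℝ) ^ (j : ℤ))))).1.1.aemeasurable

theorem rescale_block_sum (α : ℝ) (K : ℝ≥0∞) (w m : ℤ → ℝ≥0∞) (k : ℤ) :
    (2 : ℝ≥0∞) ^ ((k : ℝ) * α) * ∑' l, K * w (k - l) * m l =
      ∑' l, K * w (k - l) * (2 : ℝ≥0∞) ^ (((k - l : ℤ) : ℝ) * α) *
        ((2 : ℝ≥0∞) ^ ((l : ℝ) * α) * m l) := by
  rw [← ENNReal.tsum_mul_left]
  refine tsum_congr fun l => ?_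
  have : (2 : ℝ≥0∞) ^ ((k : ℝ) * α) =
      (2 : ℝ≥0∞) ^ (((k - l : ℤ) : ℝ) * α) * (2 : ℝ≥0∞) ^ ((l : ℝ) * α) := by
    rw [← ENNReal.rpow_add _ _ (by simp) (by simp)]
    congr 1
    push_cast
    ring
  rw [this]
  ring

/-- For a single `k` the growth bound on each annulus norm suffices, so the kernel is summed with
exponent 1 whatever `p` is. -/
theorem tsum_block_lt_top {α lam p : ℝ} (hlam : 0 ≤ lam) (hp : 0 < p)
    (hα_lower : lam - ∑ i, 1 / q i < α) (hα_upper : α < (n : ℝ) - ∑ i, 1 / q i)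
    {K : ℝ≥0∞} (hK : K ≠ ∞) {f : EuclideanSpace ℝ (Fin n) → 𝕜}
    (hf : herzMorreyNorm α lam p q f < ∞) (k : ℤ) :
    ∑' l, K * blockWeight n (∑ i, 1 / q i) (k - l) *
      mixedNorm q ((annulus n l).indicator f) < ∞ := by
  set u : ℤ → ℝ≥0∞ := fun j =>
    K * blockWeight n (∑ i, 1 / q i) j * (2 : ℝ≥0∞) ^ ((j : ℝ) * α)
  have h1 : (2 : ℝ≥0∞) ^ ((k : ℝ) * α) * ∑' l, K * blockWeight n (∑ i, 1 / q i) (k - l) *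
      mixedNorm q ((annulus n l).indicator f) ≤
      (2 : ℝ≥0∞) ^ ((k : ℝ) * lam) * herzMorreyNorm α lam p q f *
        ∑' j : ℤ, (u j * (2 : ℝ≥0∞) ^ (-(j : ℝ) * lam)) ^ (1 : ℝ) := by
    rw [rescale_block_sum α K (blockWeight n (∑ i, 1 / q i)), ← (Equiv.subLeft k).tsum_eq,
      ← ENNReal.tsum_mul_left]
    refine ENNReal.tsum_le_tsum fun j => ?_
    simp only [Equiv.subLeft_apply, sub_sub_cancel, ENNReal.rpow_one]
    rw [mul_left_comm _ (u j)]
    refine mul_le_mul' le_rfl ((mixedNorm_annulus_le (lam := lam) hp f (k - j)).trans (le_of_eq ?_))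
    rw [mul_right_comm, ← ENNReal.rpow_add _ _ (by simp) (by simp)]
    congr 2
    push_cast
    ring
  have h2 := h1.trans_lt (ENNReal.mul_lt_top (ENNReal.mul_lt_top (two_rpow_lt_top _) hf)
    (tsum_blockWeight_lt_top hα_lower hα_upper hlam hK one_pos le_rfl))
  by_contra hne
  rw [not_lt_top_iff.1 hne, ENNReal.mul_top (by simp)] at h2
  exact lt_irrefl _ h2

theorem memMixedLpLoc_maximalCommutator (hn : 1 ≤ n) {α lam p : ℝ} (hlam : 0 ≤ lam) (hp : 0 < p)
    (hq : ∀ i, 1 < q i) (hα_lower : lam - ∑ i, 1 / q i < α)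
    (hα_upper : α < (n : ℝ) - ∑ i, 1 / q i) {b : EuclideanSpace ℝ (Fin n) → 𝕜} (hb : MemBMO b)
    {C : ℝ≥0} (hC : MaximalCommutatorBound q b C) {f : EuclideanSpace ℝ (Fin n) → 𝕜}
    (hf : MemHerzMorrey α lam p q f) : MemMixedLpLoc q (maximalCommutator b f) := by
  have hq0 : ∀ i, 0 < q i := fun i => zero_lt_one.trans (hq i)
  have hbm : AEStronglyMeasurable b := hb.1.aestronglyMeasurable
  have hM := aemeasurable_maximalCommutator hC hf.1
  refine ⟨hM.aestronglyMeasurable, fun K hK => ⟨(hM.indicator hK.measurableSet).aestronglyMeasurable,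
    ?_⟩⟩
  obtain ⟨R, hR⟩ := hK.isBounded.subset_closedBall 0
  obtain ⟨m, hm⟩ := pow_unbounded_of_one_lt R one_lt_two
  set k : ℤ := (m : ℤ) with hk
  set B : Set (EuclideanSpace ℝ (Fin n)) := closedBall 0 ((2 : ℝ) ^ k) with hB
  set D : Set (EuclideanSpace ℝ (Fin n)) := closedBall 0 ((2 : ℝ) ^ (k + 1)) with hD
  have hKB : K ⊆ B := hR.trans (closedBall_subset_closedBall (by
    rw [hk, zpow_natCast]; exact hm.le))
  -- Summing the bounds over all annuli inside `K` could diverge near the origin. Instead the part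
  -- of `f` in `D` is handled by the bound on `L^q`, and the rest, vanishing on `D`, by the block
  -- estimate on the whole ball `B`.
  have hfin : MemMixedLp q (D.indicator f) := hf.1.2 _ (isCompact_closedBall _ _)
  set g := Dᶜ.indicator f with hg
  have hgm : AEStronglyMeasurable g := hf.1.1.indicator measurableSet_closedBall.compl
  have hgl : ∀ l x, ‖(annulus n l).indicator g x‖ₑ ≤ ‖(annulus n l).indicator f x‖ₑ := by
    intro l x
    rw [enorm_indicator_eq_indicator_enorm, enorm_indicator_eq_indicator_enorm]
    exact Set.indicator_le_indicator (enorm_indicator_le_enorm_self f x)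
  have hgmem : ∀ l, MemMixedLp q ((annulus n l).indicator g) := fun l =>
    ⟨hgm.indicator (measurableSet_annulus l),
      (mixedNorm_mono hq0 (hgl l)).trans_lt (hf.1.annulus hq0 l).2⟩
  have hsplit : mixedNorm q (K.indicator (maximalCommutator b f)) ≤
      mixedNorm q (fun x => maximalCommutator b (D.indicator f) x +
        B.indicator (maximalCommutator b g) x) := by
    refine mixedNorm_mono hq0 fun x => ?_
    rw [enorm_eq_self, enorm_eq_self]
    by_cases hx : x ∈ K
    · rw [Set.indicator_of_mem hx, Set.indicator_of_mem (hKB hx)]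
      refine maximalCommutator_le_add hbm hfin.1 hgm (fun y => ?_) x
      by_cases hy : y ∈ D
      · rw [Set.indicator_of_mem hy]
        exact le_self_add
      · rw [hg, Set.indicator_of_mem (Set.mem_compl hy)]
        exact le_add_self
    · rw [Set.indicator_of_notMem hx]
      exact zero_le
  have hgAE : AEMeasurable (maximalCommutator b g) := by
    refine aemeasurable_maximalCommutator hC ⟨hgm, fun K' hK' => ⟨hgm.indicator hK'.measurableSet,
      (mixedNorm_mono hq0 fun x => ?_).trans_lt (hf.1.2 K' hK').2⟩⟩
    rw [enorm_indicator_eq_indicator_enorm, enorm_indicator_eq_indicator_enorm]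
    exact Set.indicator_le_indicator (enorm_indicator_le_enorm_self f x)
  have hfar : mixedNorm q (B.indicator (maximalCommutator b g)) < ∞ := by
    refine (mixedNorm_indicator_maximalCommutator_le_tsum hn hq hb.1 hC hgm hgmem
      measurableSet_closedBall subset_rfl (Or.inr fun y hy => ?_)).trans_lt
      (lt_of_le_of_lt (ENNReal.tsum_le_tsum fun l => mul_le_mul' le_rfl
        (mixedNorm_mono hq0 (hgl l))) (tsum_block_lt_top hlam hp hα_lower hα_upper
        (blockConst_ne_top hb.2) hf.2 k))
    exact Set.indicator_of_notMem (Set.notMem_compl_iff.2 hy) _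
  refine (hsplit.trans (mixedNorm_add_le (fun i => (hq i).le) (hC _ hfin).1.1.aemeasurable
    (hgAE.indicator measurableSet_closedBall))).trans_lt ?_
  exact ENNReal.add_lt_top.2 ⟨(hC _ hfin).1.2, hfar⟩

end HerzMorreyBound

end HerzMorrey

end

/-! ### The boundedness theorem. -/

theorem theorem4p1 {n : ℕ} (hn : 1 ≤ n) {𝕜 : Type*} [RCLike 𝕜]
    (α lam p : ℝ) (q : Fin n → ℝ)
    (hlam : 0 ≤ lam) (hp : 0 < p) (hq : ∀ i, 1 < q i)
    (hα_lower : lam - ∑ i, 1 / q i < α) (hα_upper : α < (n : ℝ) - ∑ i, 1 / q i)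
    (b : EuclideanSpace ℝ (Fin n) → 𝕜) (hb : HerzMorrey.MemBMO b)
    (hMb : ∃ C : ℝ≥0, ∀ f : EuclideanSpace ℝ (Fin n) → 𝕜, HerzMorrey.MemMixedLp q f →
      HerzMorrey.MemMixedLp q (HerzMorrey.maximalCommutator b f) ∧
      HerzMorrey.mixedNorm q (HerzMorrey.maximalCommutator b f) ≤
        (C : ℝ≥0∞) * HerzMorrey.mixedNorm q f) :
    ∃ C : ℝ≥0, ∀ f : EuclideanSpace ℝ (Fin n) → 𝕜, HerzMorrey.MemHerzMorrey α lam p q f →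
      HerzMorrey.MemHerzMorrey α lam p q (HerzMorrey.maximalCommutator b f) ∧
      HerzMorrey.herzMorreyNorm α lam p q (HerzMorrey.maximalCommutator b f) ≤
        (C : ℝ≥0∞) * HerzMorrey.herzMorreyNorm α lam p q f := by
  open HerzMorrey in
  obtain ⟨C, hC⟩ := hMb
  replace hC : MaximalCommutatorBound q b C := hC
  have hq0 : ∀ i, 0 < q i := fun i => zero_lt_one.trans (hq i)
  have hs : 0 < min p 1 := lt_min hp one_pos
  set u : ℤ → ℝ≥0∞ := fun j =>
    blockConst C b * blockWeight n (∑ i, 1 / q i) j * (2 : ℝ≥0∞) ^ ((j : ℝ) * α)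
  have hA := ENNReal.rpow_lt_top_of_nonneg (y := 1 / min p 1) (by positivity)
    (tsum_blockWeight_lt_top hα_lower hα_upper hlam (blockConst_ne_top (C := C) hb.2) hs
      (min_le_right p 1)).ne
  -- The operator constant is the `ℓ^{min(p,1)}` quasi-norm of the kernel weighted by the Morrey
  -- cost of each shift.
  set A : ℝ≥0∞ :=
    (∑' j : ℤ, (u j * (2 : ℝ≥0∞) ^ (-(j : ℝ) * lam)) ^ min p 1) ^ (1 / min p 1)
  have hbound : ∀ f : EuclideanSpace ℝ (Fin n) → 𝕜, MemHerzMorrey α lam p q f →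
      herzMorreyNorm α lam p q (maximalCommutator b f) ≤
        (A.toNNReal : ℝ≥0∞) * herzMorreyNorm α lam p q f := by
    intro f hf
    rw [ENNReal.coe_toNNReal hA.ne]
    refine herzMorreyNorm_le hp _ fun k₀ => ?_
    refine (morrey_convolution_le hp u
      (fun k => (2 : ℝ≥0∞) ^ ((k : ℝ) * α) *
        mixedNorm q ((annulus n k).indicator (maximalCommutator b f)))
      (fun k => (2 : ℝ≥0∞) ^ ((k : ℝ) * α) * mixedNorm q ((annulus n k).indicator f))
      (herzMorreyNorm α lam p q f) (fun k => ?_)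
      (tsum_rpow_le_of_herzMorreyNorm hp f) k₀).trans (le_of_eq ?_)
    · refine (mul_le_mul' le_rfl (mixedNorm_indicator_maximalCommutator_le_tsum hn hq hb.1 hC
        hf.1.1 (fun l => hf.1.annulus hq0 l) (measurableSet_annulus k) Set.sdiff_subset
        (Or.inl subset_rfl))).trans (le_of_eq ?_)
      exact rescale_block_sum α (blockConst C b) (blockWeight n (∑ i, 1 / q i)) _ k
    · rw [mul_assoc, mul_comm _ A]
  exact ⟨A.toNNReal, fun f hf => ⟨⟨memMixedLpLoc_maximalCommutator hn hlam hp hq hα_lower hα_upper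
    hb hC hf, (hbound f hf).trans_lt (ENNReal.mul_lt_top ENNReal.coe_lt_top hf.2)⟩, hbound f hf⟩⟩
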